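/- **Theorem 1.2.** Let $\beta>0$ and $h>0$, and let $p=p(N)\in(0,1]$ satisfy $p^3N\to\infty$ as $N\to\infty$. For each $N$ let $(\varepsilon_{i,j})_{i,j=1}^N=(\varepsilon^N_{i,j})_{i,j=1}^N$ be i.i.d. with $\mathbb P[\varepsilon_{i,j}=1]=p$ and $\mathbb P[\varepsilon_{i,j}=0]=1-p$ (the edge indicators of a directed Erdős–Rényi graph $G(N,p)$ with loops admitted). For $\sigma\in\{-1,+1\}^N$ put $$H(\sigma)=-\frac1{2Np}\sum_{i,j=1}^N\varepsilon_{i,j}\sigma_i\sigma_j-h\sum_{i=1}^N\sigma_i,\qquad Z_N(\beta)=\sum_{\sigma\in\{-1,+1\}^N}e^{-\beta H(\sigma)}.$$ Let $m^+(\beta,h)$ be the largest solution of $z=\tanh(\beta(z+h))$ and let $$\sigma^2(\beta,h)=\frac{1-m^+(\beta,h)^2}{1-\beta\,(1-m^+(\beta,h)^2)}.$$ Then $\sigma^2(\beta,h)>0$, and the random measure $$L_N=\frac1{Z_N(\beta)}\sum_{\sigma\in\{-1,+1\}^N}e^{-\beta H(\sigma)}\,\delta_{\frac1{\sqrt N}\left(\sum_{i=1}^N\sigma_i-N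 m^+(\beta,h)\right)},$$ considered as a random element of the space $\mathcal M(\mathbb R)$ of finite measures on $\mathbb R$ with the topology of weak convergence, converges in probability to the normal distribution $\mathfrak N_{0,\sigma^2(\beta,h)}$ with mean $0$ and variance $\sigma^2(\beta,h)$. That is, for every neighbourhood $U$ of $\mathfrak N_{0,\sigma^2(\beta,h)}$ in $\mathcal M(\mathbb R)$ we have $\lim_{N\to\infty}\mathbb P[L_N\notin U]=0$; in other words, for every metric $\rho$ on $\mathcal M(\mathbb R)$ that generates the weak topology and every $\delta>0$, $$\lim_{N\to\infty}\mathbb P\left[\rho\left(L_N,\mathfrak N_{0,\sigma^2(\beta,h)}\right)>\delta\right]=0.$$ -/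

import Mathlib

open Filter Topology MeasureTheory ProbabilityTheory

namespace DiluteCurieWeiss

/-- The directed Erdős–Rényi graph `G(N, p)`, loops admitted: the edge indicators
`ε i j`, for all ordered pairs `(i, j)`, are i.i.d. with
`P[ε i j = 1] = p` and `P[ε i j = 0] = 1 - p`. -/
structure IsErdosRenyi {Ω : Type*} [MeasurableSpace Ω] (P : Measure Ω) (N : ℕ) (p : ℝ)
    (ε : Fin N → Fin N → Ω → ℝ) : Prop where
  measurable : ∀ i j, Measurable (ε i j)
  indep : iIndepFun (fun e : Fin N × Fin N => ε e.1 e.2) P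
  prob_one : ∀ i j, P {ω | ε i j ω = 1} = ENNReal.ofReal p
  prob_zero : ∀ i j, P {ω | ε i j ω = 0} = ENNReal.ofReal (1 - p)

/-- Spin configurations `σ ∈ {-1, +1}^N` (the units of `ℤ` are exactly `1` and `-1`). -/
abbrev Config (N : ℕ) : Type := Fin N → ℤˣ

/-- The spin `σ i` as a real number. -/
def spin {N : ℕ} (σ : Config N) (i : Fin N) : ℝ := ((σ i : ℤ) : ℝ)

/-- The Hamiltonian
`H(σ) = - (1 / (2 N p)) ∑_{i,j} a i j σ_i σ_j - h ∑_i σ_i`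
for a given matrix `a` of edge indicators. -/
noncomputable def hamiltonian (N : ℕ) (p h : ℝ) (a : Fin N → Fin N → ℝ) (σ : Config N) : ℝ :=
  -(1 / (2 * (N : ℝ) * p)) * ∑ i, ∑ j, a i j * spin σ i * spin σ j - h * ∑ i, spin σ i

/-- The partition function `Z_N(β) = ∑_σ exp(-β H(σ))`. -/
noncomputable def partitionFunction (N : ℕ) (p β h : ℝ) (a : Fin N → Fin N → ℝ) : ℝ :=
  ∑ σ : Config N, Real.exp (-β * hamiltonian N p h a σ)

/-- The Gibbs weight `μ_β(σ) = exp(-β H(σ)) / Z_N(β)`. -/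
noncomputable def gibbs (N : ℕ) (p β h : ℝ) (a : Fin N → Fin N → ℝ) (σ : Config N) : ℝ :=
  Real.exp (-β * hamiltonian N p h a σ) / partitionFunction N p β h a

/-- The Dirac measure at `x`, as a finite measure on `ℝ`. -/
noncomputable def diracFM (x : ℝ) : FiniteMeasure ℝ := ⟨Measure.dirac x, inferInstance⟩

/-- The normal distribution with mean `0` and variance `v` (for `v ≥ 0`), as a finite
measure on `ℝ`. -/
noncomputable def normalFM (v : ℝ) : FiniteMeasure ℝ :=
  ⟨gaussianReal 0 v.toNNReal, inferInstance⟩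

/-- The set of solutions of the Curie–Weiss equation `z = tanh (β (z + h))`. -/
def cwSolutions (β h : ℝ) : Set ℝ := {z | z = Real.tanh (β * (z + h))}

/-- `m⁺(β, h)`, the largest solution of `z = tanh (β (z + h))`; see `isGreatest_mPlus`. -/
noncomputable def mPlus (β h : ℝ) : ℝ := sSup (cwSolutions β h)

/-- The largest solution exists, and it is `mPlus β h`. -/
theorem isGreatest_mPlus (β h : ℝ) : IsGreatest (cwSolutions β h) (mPlus β h) := by
  have hc : Continuous fun z : ℝ => Real.tanh (β * (z + h)) := by
    have : (fun z : ℝ => Real.tanh (β * (z + h))) =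
        fun z => Real.sinh (β * (z + h)) / Real.cosh (β * (z + h)) := by
      funext z; exact Real.tanh_eq_sinh_div_cosh _
    rw [this]
    exact Continuous.div (by fun_prop) (by fun_prop) fun z => (Real.cosh_pos _).ne'
  have hclosed : IsClosed (cwSolutions β h) := isClosed_eq continuous_id hc
  have hlt : ∀ x : ℝ, Real.tanh x < 1 := fun x => Real.tanh_lt_one x
  have hgt : ∀ x : ℝ, -1 < Real.tanh x := fun x => Real.neg_one_lt_tanh x
  have hne : (cwSolutions β h).Nonempty := by
    obtain ⟨z, _, hz⟩ := intermediate_value_Icc (by norm_num : (-1 : ℝ) ≤ 1)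
      (f := fun z => z - Real.tanh (β * (z + h))) (by fun_prop)
      (show (0 : ℝ) ∈ Set.Icc _ _ from
        ⟨by have := hgt (β * (-1 + h)); linarith,
          by have := hlt (β * (1 + h)); linarith⟩)
    exact ⟨z, sub_eq_zero.mp hz⟩
  have hbdd : BddAbove (cwSolutions β h) :=
    ⟨1, fun z (hz : z = _) => by rw [hz]; exact (hlt _).le⟩
  exact ⟨hclosed.csSup_mem hne hbdd, fun z hz => le_csSup hbdd hz⟩

/-- `σ²(β, h) = (1 - m⁺(β,h)²) / (1 - β (1 - m⁺(β,h)²))`. -/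
noncomputable def sigmaSq (β h : ℝ) : ℝ :=
  (1 - mPlus β h ^ 2) / (1 - β * (1 - mPlus β h ^ 2))

/-- `L_N = (1 / Z_N(β)) ∑_σ exp(-β H(σ)) δ_{(∑_i σ_i - N m⁺(β,h)) / √N}`, the law under the
Gibbs measure of the rescaled magnetization, for a given matrix `a` of edge indicators. -/
noncomputable def magnetizationLaw (N : ℕ) (p β h : ℝ) (a : Fin N → Fin N → ℝ) :
    FiniteMeasure ℝ :=
  ∑ σ : Config N, (gibbs N p β h a σ).toNNReal •
    diracFM ((1 / Real.sqrt N) * ((∑ i, spin σ i) - N * mPlus β h))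

end DiluteCurieWeiss

namespace DiluteCurieWeiss

/-! Put m = `mPlus β h`, a = β(m + h), so m = tanh a, and compare the Gibbs measure with independent
spins of mean m. With x the rescaled magnetization and γ = β/(2Np), `exp_neg_hamiltonian` writes the
Gibbs weight, up to a factor independent of the configuration, as the product weight times
exp(βx²/2) times exp(∑ γ(σᵢσⱼ - m²)(εᵢⱼ - p)). Subtracting m² moves the random factor exp(γm² ∑(εᵢⱼ
- p)) into the normalization; its exponent has variance of order 1/p when p is small, so it need not
concentrate.

Without disorder, x is asymptotically Gaussian with variance s = 1 - m², and the factor exp(βx²/2)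
turns this variance into s/(1 - βs) = σ². Uniform integrability comes from the sub-Gaussian bound
with constant tanh a / a (`cosh_add_div_cosh_le`): β tanh a / a = m/(m + h) < 1 because h > 0. This
bound is global, so no separate large deviation estimate is needed.

The disorder is handled by a second moment computation. The expected edge factor of one
configuration is e^V, with V = `logMean`, and that of a pair of configurations is e^{2V}, up to
exponents of order 1/(p√N) times one plus the squares of the two magnetizations and, for a pair, of
the overlap fluctuation (`expect_weight`, `expect_weight_pair`). These squares have uniform
exponential moments (`exists_exp_moment_bound`). Hence e^{-V} times an unnormalized Gibbs sum
converges in L² to a constant (`integral_sq_sub_le`, `tendsto_gibbsSum`), and quotients of such sums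
give the integrals against L_N. The hypothesis on p enters only through p√N → ∞. -/

/-! ### Hyperbolic inequalities and one-variable Laplace transforms -/

theorem hasDerivAt_tanh (x : ℝ) : HasDerivAt Real.tanh (1 / Real.cosh x ^ 2) x := by
  have h := (Real.hasDerivAt_sinh x).div (Real.hasDerivAt_cosh x) (Real.cosh_pos x).ne'
  have he : Real.tanh = fun y => Real.sinh y / Real.cosh y :=
    funext fun y => Real.tanh_eq_sinh_div_cosh y
  rw [he]
  refine h.congr_deriv ?_
  have := Real.cosh_sq x
  congr 1
  linarith

theorem tanh_pos {x : ℝ} (hx : 0 < x) : 0 < Real.tanh x := by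
  rw [Real.tanh_eq_sinh_div_cosh]
  exact div_pos (Real.sinh_pos_iff.2 hx) (Real.cosh_pos x)

theorem self_le_sinh_mul_cosh {x : ℝ} (hx : 0 ≤ x) : x ≤ Real.sinh x * Real.cosh x := by
  have h1 := Real.self_le_sinh_iff.2 hx
  have h2 := Real.one_le_cosh x
  nlinarith

theorem antitoneOn_tanh_div_self : AntitoneOn (fun x => Real.tanh x / x) (Set.Ioi 0) := by
  have hd : ∀ x ∈ Set.Ioi (0 : ℝ), HasDerivAt (fun x => Real.tanh x / x)
      ((1 / Real.cosh x ^ 2 * x - Real.tanh x * 1) / x ^ 2) x := fun x hx =>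
    (hasDerivAt_tanh x).div (hasDerivAt_id x) (ne_of_gt hx)
  refine antitoneOn_of_deriv_nonpos (convex_Ioi 0)
    (fun x hx => (hd x hx).continuousAt.continuousWithinAt)
    (fun x hx => (hd x (interior_subset hx)).differentiableAt.differentiableWithinAt) ?_
  intro x hx
  have hx' : (0 : ℝ) < x := interior_subset hx
  rw [(hd x hx').deriv]
  refine div_nonpos_of_nonpos_of_nonneg ?_ (sq_nonneg x)
  have hc := Real.cosh_pos x
  have := self_le_sinh_mul_cosh hx'.le
  rw [Real.tanh_eq_sinh_div_cosh]
  have he : 1 / Real.cosh x ^ 2 * x - Real.sinh x / Real.cosh x * 1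
      = (x - Real.sinh x * Real.cosh x) / Real.cosh x ^ 2 := by field_simp
  rw [he]
  exact div_nonpos_of_nonpos_of_nonneg (by linarith) (sq_nonneg _)

theorem tanh_div_self_le_one {a : ℝ} (ha : 0 < a) : Real.tanh a / a ≤ 1 := by
  rw [div_le_one ha, Real.tanh_eq_sinh_div_cosh, div_le_iff₀ (Real.cosh_pos a)]
  have hm : MonotoneOn (fun x => x * Real.cosh x - Real.sinh x) (Set.Ici 0) := by
    have hd : ∀ x : ℝ, HasDerivAt (fun x => x * Real.cosh x - Real.sinh x)
        (1 * Real.cosh x + x * Real.sinh x - Real.cosh x) x := fun x =>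
      ((hasDerivAt_id x).mul (Real.hasDerivAt_cosh x)).sub (Real.hasDerivAt_sinh x)
    refine monotoneOn_of_deriv_nonneg (convex_Ici 0)
      (fun x _ => (hd x).continuousAt.continuousWithinAt)
      (fun x _ => (hd x).differentiableAt.differentiableWithinAt) fun x hx => ?_
    have hx' : (0 : ℝ) ≤ x := interior_subset hx
    rw [(hd x).deriv]
    nlinarith [Real.sinh_nonneg_iff.2 hx']
  have := hm (Set.mem_Ici.2 le_rfl) (Set.mem_Ici.2 ha.le) ha.le
  simp at this
  linarith

/-- The variance of a spin is at most its sub-Gaussian constant. Hence β tanh a / a < 1 also makes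
the denominator of the limiting variance positive. -/
theorem one_sub_tanh_sq_le {a : ℝ} (ha : 0 < a) : 1 - Real.tanh a ^ 2 ≤ Real.tanh a / a := by
  have hc := Real.cosh_pos a
  rw [le_div_iff₀ ha, Real.tanh_eq_sinh_div_cosh]
  have he : (1 - (Real.sinh a / Real.cosh a) ^ 2) = 1 / Real.cosh a ^ 2 := by
    have := Real.cosh_sq a
    field_simp
    linarith
  rw [he, one_div_mul_eq_div, div_le_div_iff₀ (by positivity) hc]
  nlinarith [self_le_sinh_mul_cosh ha.le]

/-- `log cosh` is concave as a function of the square of its argument. -/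
theorem log_cosh_le {a : ℝ} (ha : 0 < a) (b : ℝ) :
    Real.log (Real.cosh b) ≤
      Real.log (Real.cosh a) + Real.tanh a / (2 * a) * (b ^ 2 - a ^ 2) := by
  wlog hb : 0 ≤ b generalizing b
  · have := this (-b) (by linarith)
    simpa using this
  -- `D` is the tangent line, in the variable b², minus log cosh. For x > 0 its derivative is x(tanh
  -- a / a - tanh x / x), which changes sign from negative to positive at a, so a is the minimum on
  -- the half-line, where `D` vanishes.
  set D : ℝ → ℝ := fun b => Real.tanh a / (2 * a) * (b ^ 2 - a ^ 2) - Real.log (Real.cosh b) with hD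
  have hd : ∀ x : ℝ, HasDerivAt D (Real.tanh a / a * x - Real.tanh x) x := fun x => by
    have h1 := ((((hasDerivAt_id x).pow 2).sub_const (a ^ 2)).const_mul
      (Real.tanh a / (2 * a))).sub ((Real.hasDerivAt_cosh x).log (Real.cosh_pos x).ne')
    refine h1.congr_deriv ?_
    rw [← Real.tanh_eq_sinh_div_cosh]
    simp
    field_simp
  have hkey : D a ≤ D b := by
    rcases le_total b a with hba | hab
    · have : AntitoneOn D (Set.Icc 0 a) := by
        refine antitoneOn_of_deriv_nonpos (convex_Icc 0 a)
          (fun x _ => (hd x).continuousAt.continuousWithinAt)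
          (fun x _ => (hd x).differentiableAt.differentiableWithinAt) fun x hx => ?_
        rw [interior_Icc] at hx
        rw [(hd x).deriv]
        have := antitoneOn_tanh_div_self (Set.mem_Ioi.2 hx.1) (Set.mem_Ioi.2 ha) hx.2.le
        simp only at this
        rw [le_div_iff₀ hx.1] at this
        linarith
      exact this ⟨hb, hba⟩ ⟨ha.le, le_rfl⟩ hba
    · have : MonotoneOn D (Set.Ici a) := by
        refine monotoneOn_of_deriv_nonneg (convex_Ici a)
          (fun x _ => (hd x).continuousAt.continuousWithinAt)
          (fun x _ => (hd x).differentiableAt.differentiableWithinAt) fun x hx => ?_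
        rw [interior_Ici] at hx
        rw [(hd x).deriv]
        have hx0 : 0 < x := ha.trans hx
        have := antitoneOn_tanh_div_self (Set.mem_Ioi.2 ha) (Set.mem_Ioi.2 hx0) (le_of_lt hx)
        simp only at this
        rw [div_le_iff₀ hx0] at this
        linarith
      exact this Set.self_mem_Ici hab hab
  simp only [hD, sub_self, mul_zero, zero_sub] at hkey
  linarith

/-- The sub-Gaussian bound, with the optimal constant, for a spin of mean `tanh a`. -/
theorem cosh_add_div_cosh_le {a : ℝ} (ha : 0 < a) (t : ℝ) :
    Real.cosh (a + t) / Real.cosh a ≤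
      Real.exp (t * Real.tanh a + Real.tanh a / a * t ^ 2 / 2) := by
  have h := log_cosh_le ha (a + t)
  rw [← Real.log_le_iff_le_exp (div_pos (Real.cosh_pos _) (Real.cosh_pos _)),
    Real.log_div (Real.cosh_pos _).ne' (Real.cosh_pos _).ne', sub_le_iff_le_add']
  refine h.trans (le_of_eq ?_)
  field_simp
  ring

/-- The left side is the Laplace transform of a spin of mean μ. It serves for the product of two
independent replica spins, of mean tanh² a; there the cruder constant 1 in place of tanh a / a is
enough. -/
theorem cosh_add_mul_sinh_le {μ : ℝ} (h0 : 0 < μ) (h1 : μ < 1) (t : ℝ) :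
    Real.cosh t + μ * Real.sinh t ≤ Real.exp (t * μ + t ^ 2 / 2) := by
  obtain ⟨a, -, rfl⟩ := Real.tanh_surjOn (show μ ∈ Set.Ioo (-1) 1 from ⟨by linarith, h1⟩)
  have ha : 0 < a := by
    by_contra hn
    rcases eq_or_lt_of_le (not_lt.1 hn) with h | h
    · simp [h] at h0
    · have := tanh_pos (x := -a) (by linarith)
      rw [Real.tanh_neg] at this
      linarith
  have hc := Real.cosh_pos a
  have h := cosh_add_div_cosh_le ha t
  have he : Real.cosh (a + t) / Real.cosh a = Real.cosh t + Real.tanh a * Real.sinh t := by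
    rw [Real.cosh_add, Real.tanh_eq_sinh_div_cosh]
    field_simp
  rw [he] at h
  refine h.trans (Real.exp_le_exp.2 ?_)
  nlinarith [tanh_div_self_le_one ha, sq_nonneg t]

/-- The Laplace transform of a centred Bernoulli variable at a small argument. -/
theorem bernoulli_laplace {p c : ℝ} (hp0 : 0 ≤ p) (hp1 : p ≤ 1) (hc : |c| ≤ 1 / 2) :
    ∃ e, |e| ≤ 2 * (p * |c| ^ 3) ∧
      (1 - p) * Real.exp (c * (0 - p)) + p * Real.exp (c * (1 - p)) =
        Real.exp (p * (1 - p) * c ^ 2 / 2 + e) := by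
  set ψ := (1 - p) * Real.exp (c * (0 - p)) + p * Real.exp (c * (1 - p)) with hψ
  set u := ψ - 1 with hu
  have hexp : ∀ y : ℝ, |y| ≤ |c| → |Real.exp y - (1 + y + y ^ 2 / 2)| ≤ 2 / 9 * |y| ^ 3 := by
    intro y hy
    have := Real.exp_bound (x := y) (by linarith) (n := 3) (by norm_num)
    norm_num [Finset.sum_range_succ, Nat.factorial] at this
    linarith
  have hab : |c * (0 - p)| = |c| * p := by rw [abs_mul, zero_sub, abs_neg, abs_of_nonneg hp0]
  have hab' : |c * (1 - p)| = |c| * (1 - p) := by rw [abs_mul, abs_of_nonneg (by linarith : 0 ≤ 1 - p)]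
  have hcn := abs_nonneg c
  have e1 := hexp (c * (0 - p)) (by rw [hab]; nlinarith)
  have e2 := hexp (c * (1 - p)) (by rw [hab']; nlinarith)
  rw [hab] at e1
  rw [hab'] at e2
  have hq : 0 ≤ 1 - p := by linarith
  have hcube : 0 ≤ |c| ^ 3 := by positivity
  -- The linear terms cancel by centring. The factor p must survive in the error: summed over N²
  -- edges with c of order 1/(Np), it gives 1/(p²N) instead of 1/(p³N).
  have huq : |u - p * (1 - p) * c ^ 2 / 2| ≤ 4 / 9 * (p * |c| ^ 3) := by
    have he : u - p * (1 - p) * c ^ 2 / 2 =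
        (1 - p) * (Real.exp (c * (0 - p)) - (1 + c * (0 - p) + (c * (0 - p)) ^ 2 / 2)) +
        p * (Real.exp (c * (1 - p)) - (1 + c * (1 - p) + (c * (1 - p)) ^ 2 / 2)) := by
      rw [hu, hψ]; ring
    rw [he]
    refine (abs_add_le _ _).trans ?_
    rw [abs_mul, abs_mul, abs_of_nonneg hq, abs_of_nonneg hp0]
    have f1 : (1 - p) * (2 / 9 * (|c| * p) ^ 3) ≤ 2 / 9 * (p * |c| ^ 3) := by
      have : (1 - p) * p ^ 3 ≤ p := by
        have : p ^ 3 ≤ p := by nlinarith [mul_nonneg hp0 hp0, mul_nonneg (mul_nonneg hp0 hp0) hq, mul_nonneg hp0 hq]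
        have : 0 ≤ p ^ 3 := by positivity
        nlinarith
      calc _ = 2 / 9 * (((1 - p) * p ^ 3) * |c| ^ 3) := by ring
        _ ≤ _ := by gcongr
    have f2 : p * (2 / 9 * (|c| * (1 - p)) ^ 3) ≤ 2 / 9 * (p * |c| ^ 3) := by
      have : (1 - p) ^ 3 ≤ 1 := pow_le_one₀ hq (by linarith)
      calc _ = 2 / 9 * ((p * |c| ^ 3) * (1 - p) ^ 3) := by ring
        _ ≤ 2 / 9 * ((p * |c| ^ 3) * 1) := by gcongr
        _ = _ := by ring
    nlinarith [mul_le_mul_of_nonneg_left e1 hq, mul_le_mul_of_nonneg_left e2 hp0]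
  have hc2 : |c| ^ 2 = c ^ 2 := sq_abs c
  have hu2 : |u| ≤ p * |c| ^ 2 := by
    have h1 : |p * (1 - p) * c ^ 2 / 2| ≤ p * |c| ^ 2 / 2 := by
      rw [abs_of_nonneg (by positivity), hc2]
      nlinarith [mul_nonneg hp0 (sq_nonneg c), mul_nonneg (mul_nonneg hp0 hp0) (sq_nonneg c)]
    have h2 : |c| ^ 3 ≤ |c| ^ 2 * (1 / 2) := by
      rw [pow_succ]; gcongr
    have h3 := abs_add_le (u - p * (1 - p) * c ^ 2 / 2) (p * (1 - p) * c ^ 2 / 2)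
    rw [sub_add_cancel] at h3
    nlinarith [mul_le_mul_of_nonneg_left h2 hp0, mul_nonneg hp0 (sq_nonneg |c|)]
  have hcq : |c| ^ 2 ≤ 1 / 4 := by nlinarith
  have hu4 : |u| ≤ 1 / 4 := hu2.trans (by nlinarith [sq_nonneg |c|])
  have hψpos : 0 < ψ := by have := abs_le.1 hu4; linarith
  have husq : u ^ 2 ≤ p * |c| ^ 3 / 2 := by
    rw [← sq_abs u]
    calc |u| ^ 2 ≤ (p * |c| ^ 2) ^ 2 := by gcongr
      _ = p * |c| ^ 3 * (p * |c|) := by ring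
      _ ≤ p * |c| ^ 3 * (1 * (1 / 2)) := by gcongr
      _ = _ := by ring
  have hlog : |Real.log ψ - u| ≤ 4 / 3 * u ^ 2 := by
    have h1 := Real.log_le_sub_one_of_pos hψpos
    have h2 := Real.one_sub_inv_le_log_of_pos hψpos
    have h3 : u - (1 - ψ⁻¹) = u ^ 2 / ψ := by rw [hu]; field_simp
    have h4 : u ^ 2 / ψ ≤ 4 / 3 * u ^ 2 := by
      rw [div_le_iff₀ hψpos]
      have := abs_le.1 hu4
      nlinarith [sq_nonneg u]
    rw [abs_le]
    constructor
    · linarith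
    · have := sq_nonneg u
      linarith
  refine ⟨Real.log ψ - p * (1 - p) * c ^ 2 / 2, ?_, ?_⟩
  · have h3 := abs_add_le (Real.log ψ - u) (u - p * (1 - p) * c ^ 2 / 2)
    rw [sub_add_sub_cancel] at h3
    have := mul_nonneg hp0 hcube
    linarith
  · rw [add_sub_cancel, Real.exp_log hψpos]

/-! ### Quadratic reweighting of centred Gaussians -/

section Gaussian
open scoped NNReal

theorem gaussianPDFReal_mul_exp {b : ℝ} {v w : ℝ≥0} (hv : v ≠ 0) (hw : w ≠ 0)
    (hb : (w : ℝ)⁻¹ = (v : ℝ)⁻¹ - b) (u : ℝ) :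
    gaussianPDFReal 0 v u * Real.exp (b * u ^ 2 / 2) =
      Real.sqrt (w / v) * gaussianPDFReal 0 w u := by
  have hv' : (0 : ℝ) < v := by positivity
  have hw' : (0 : ℝ) < w := by positivity
  rw [gaussianPDFReal_def, gaussianPDFReal_def]
  simp only [sub_zero]
  have h1 : Real.exp (-u ^ 2 / (2 * v)) * Real.exp (b * u ^ 2 / 2) = Real.exp (-u ^ 2 / (2 * w)) := by
    rw [← Real.exp_add]
    congr 1
    have : -u ^ 2 / (2 * (w : ℝ)) = -u ^ 2 / 2 * (w : ℝ)⁻¹ := by field_simp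
    rw [this, hb]
    field_simp
    ring
  rw [mul_assoc, h1, ← mul_assoc]
  congr 1
  rw [← Real.sqrt_inv, ← Real.sqrt_inv, ← Real.sqrt_mul (by positivity)]
  congr 1
  field_simp

theorem integral_mul_exp_gaussianReal {b : ℝ} {v w : ℝ≥0} (hv : v ≠ 0) (hw : w ≠ 0)
    (hb : (w : ℝ)⁻¹ = (v : ℝ)⁻¹ - b) (g : ℝ → ℝ) :
    ∫ u, g u * Real.exp (b * u ^ 2 / 2) ∂(gaussianReal 0 v) =
      Real.sqrt (w / v) * ∫ u, g u ∂(gaussianReal 0 w) := by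
  rw [integral_gaussianReal_eq_integral_smul hv, integral_gaussianReal_eq_integral_smul hw,
    ← integral_const_mul]
  congr 1
  ext u
  simp only [smul_eq_mul]
  linear_combination (g u) * gaussianPDFReal_mul_exp hv hw hb u

theorem integrable_exp_sq_gaussianReal {b : ℝ} {v : ℝ≥0} (hv : v ≠ 0) (hb : b * v < 1) :
    Integrable (fun u => Real.exp (b * u ^ 2 / 2)) (gaussianReal 0 v) := by
  have hv' : (0 : ℝ) < v := by positivity
  have hw : 0 < (v : ℝ)⁻¹ - b := by
    rw [sub_pos, ← one_div, lt_div_iff₀ hv']; exact hb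
  set w : ℝ≥0 := ((v : ℝ)⁻¹ - b)⁻¹.toNNReal with hwdef
  have hwc : (w : ℝ) = ((v : ℝ)⁻¹ - b)⁻¹ := Real.coe_toNNReal _ (by positivity)
  have hw0 : w ≠ 0 := by
    intro h0
    rw [h0] at hwc
    have : 0 < ((v : ℝ)⁻¹ - b)⁻¹ := by positivity
    simp at hwc
    linarith
  rw [gaussianReal_of_var_ne_zero _ hv, integrable_withDensity_iff_integrable_smul'
    (measurable_gaussianPDF 0 v) (ae_of_all _ fun _ => gaussianPDF_lt_top)]
  have : (fun u => (gaussianPDF 0 v u).toReal • Real.exp (b * u ^ 2 / 2)) =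
      fun u => Real.sqrt (w / v) * gaussianPDFReal 0 w u := by
    ext u
    rw [toReal_gaussianPDF, smul_eq_mul]
    exact gaussianPDFReal_mul_exp hv hw0 (by rw [hwc, inv_inv]) u
  rw [this]
  exact (integrable_gaussianPDFReal 0 w).const_mul _

end Gaussian

/-! ### Independent spins: exponential moments -/

theorem sum_config_prod {R : Type*} [CommSemiring R] {N : ℕ} (f : Fin N → ℤˣ → R) :
    ∑ σ : Config N, ∏ i, f i (σ i) = ∏ i, (f i 1 + f i (-1)) := by
  classical
  have h := Finset.prod_univ_sum (fun _ : Fin N => (Finset.univ : Finset ℤˣ)) f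
  rw [Fintype.piFinset_univ] at h
  rw [← h]
  refine Finset.prod_congr rfl fun i _ => ?_
  rw [show (Finset.univ : Finset ℤˣ) = {1, -1} from rfl, Finset.sum_pair (by decide)]

/-- The law of a sequence of independent spins of mean `tanh a`. -/
noncomputable def prodWeight (a : ℝ) {N : ℕ} (σ : Config N) : ℝ :=
  ∏ i, (Real.exp (a * spin σ i) / (2 * Real.cosh a))

/-- The rescaled deviation of the magnetization from `m`. -/
noncomputable def fluct (m : ℝ) {N : ℕ} (σ : Config N) : ℝ :=
  (1 / Real.sqrt N) * ((∑ i, spin σ i) - N * m)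

theorem prodWeight_pos (a : ℝ) {N : ℕ} (σ : Config N) : 0 < prodWeight a σ :=
  Finset.prod_pos fun _ _ => div_pos (Real.exp_pos _) (mul_pos two_pos (Real.cosh_pos a))

theorem sum_prodWeight_mul_prod (a : ℝ) {N : ℕ} (f : Fin N → ℤˣ → ℝ) :
    ∑ σ : Config N, prodWeight a σ * ∏ i, f i (σ i) =
      ∏ i, (Real.exp a * f i 1 + Real.exp (-a) * f i (-1)) / (2 * Real.cosh a) := by
  have h := sum_config_prod
    fun (i : Fin N) (e : ℤˣ) => Real.exp (a * ((e : ℤ) : ℝ)) / (2 * Real.cosh a) * f i e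
  simp only [Finset.prod_mul_distrib] at h
  simp only [prodWeight, spin]
  rw [h]
  refine Finset.prod_congr rfl fun i _ => ?_
  simp
  ring

theorem sum_prodWeight_mul_exp (a : ℝ) {N : ℕ} (t : Fin N → ℝ) :
    ∑ σ : Config N, prodWeight a σ * Real.exp (∑ i, t i * spin σ i) =
      ∏ i, Real.cosh (a + t i) / Real.cosh a := by
  have h := sum_prodWeight_mul_prod a fun (i : Fin N) (e : ℤˣ) => Real.exp (t i * ((e : ℤ) : ℝ))
  simp only [← Real.exp_sum] at h
  simp only [spin]
  rw [h]
  refine Finset.prod_congr rfl fun i _ => ?_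
  rw [Real.cosh_eq (a + t i)]
  simp [← Real.exp_add]
  have := (Real.cosh_pos a).ne'
  field_simp
  ring_nf

theorem sum_prodWeight (a : ℝ) (N : ℕ) : ∑ σ : Config N, prodWeight a σ = 1 := by
  have h := sum_prodWeight_mul_exp a (fun _ : Fin N => (0 : ℝ))
  simpa [(Real.cosh_pos a).ne'] using h

theorem sum_prodWeight_mul_exp_fluct_le {a : ℝ} (ha : 0 < a) {N : ℕ} (hN : 1 ≤ N) (t : ℝ) :
    ∑ σ : Config N, prodWeight a σ * Real.exp (t * fluct (Real.tanh a) σ) ≤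
      Real.exp (Real.tanh a / a * t ^ 2 / 2) := by
  have hN' : (0 : ℝ) < N := by exact_mod_cast hN
  set r := t * (1 / Real.sqrt N) with hr
  have hr2 : N * r ^ 2 = t ^ 2 := by
    rw [hr, mul_pow, div_pow, Real.sq_sqrt hN'.le]; field_simp
  have h := sum_prodWeight_mul_exp a (fun _ : Fin N => r)
  have he : ∀ σ : Config N, prodWeight a σ * Real.exp (t * fluct (Real.tanh a) σ) =
      prodWeight a σ * Real.exp (∑ i, r * spin σ i) * Real.exp (-(r * N * Real.tanh a)) := by
    intro σ
    rw [mul_assoc, ← Real.exp_add, ← Finset.mul_sum, fluct, ← mul_assoc, ← hr]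
    congr 2
    ring
  simp_rw [he]
  rw [← Finset.sum_mul, h, Finset.prod_const, Finset.card_univ, Fintype.card_fin]
  have hb := pow_le_pow_left₀ (div_pos (Real.cosh_pos _) (Real.cosh_pos _)).le
    (cosh_add_div_cosh_le ha r) N
  refine (mul_le_mul_of_nonneg_right hb (Real.exp_pos _).le).trans (le_of_eq ?_)
  rw [← Real.exp_nat_mul, ← Real.exp_add]
  congr 1
  linear_combination (Real.tanh a / a / 2) * hr2

theorem spin_mul {N : ℕ} (σ τ : Config N) (i : Fin N) : spin (σ * τ) i = spin σ i * spin τ i := by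
  simp [spin]

theorem spin_sq {N : ℕ} (σ : Config N) (i : Fin N) : spin σ i ^ 2 = 1 := by
  rcases Int.units_eq_one_or (σ i) with h | h <;> simp [spin, h]

theorem abs_spin {N : ℕ} (σ : Config N) (i : Fin N) : |spin σ i| = 1 := by
  rcases Int.units_eq_one_or (σ i) with h | h <;> simp [spin, h]

/-- For independent replicas the products σᵢτᵢ are themselves independent spins of mean tanh² a. The
sum over the second replica is done first, with the first one frozen in the exponent. -/
theorem sum_prodWeight_mul_exp_overlap_le {a : ℝ} (ha : 0 < a) {N : ℕ} (hN : 1 ≤ N) (t : ℝ) :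
    ∑ q : Config N × Config N, prodWeight a q.1 * prodWeight a q.2 *
        Real.exp (t * fluct (Real.tanh a ^ 2) (q.1 * q.2)) ≤
      Real.exp (1 * t ^ 2 / 2) := by
  have hN' : (0 : ℝ) < N := by exact_mod_cast hN
  set m := Real.tanh a with hm
  have hm0 : 0 < m := tanh_pos ha
  have hm1 : m < 1 := Real.tanh_lt_one a
  set r := t * (1 / Real.sqrt N) with hr
  have hr2 : N * r ^ 2 = t ^ 2 := by
    rw [hr, mul_pow, div_pow, Real.sq_sqrt hN'.le]; field_simp
  have he : ∀ σ τ : Config N, prodWeight a σ * prodWeight a τ *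
      Real.exp (t * fluct (m ^ 2) (σ * τ)) =
      prodWeight a σ * (prodWeight a τ * Real.exp (∑ i, (r * spin σ i) * spin τ i)) *
        Real.exp (-(r * N * m ^ 2)) := by
    intro σ τ
    rw [← mul_assoc, mul_assoc _ (Real.exp _), ← Real.exp_add]
    congr 2
    simp only [mul_assoc]
    rw [← Finset.mul_sum, fluct, ← mul_assoc, ← hr]
    simp only [spin_mul]
    ring
  rw [Fintype.sum_prod_type]
  simp_rw [he, ← Finset.sum_mul, ← Finset.mul_sum]
  have h1 : ∀ σ : Config N, ∑ τ : Config N, prodWeight a τ *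
      Real.exp (∑ i, (r * spin σ i) * spin τ i) =
      ∏ i, Real.cosh (a + r * spin σ i) / Real.cosh a := fun σ =>
    sum_prodWeight_mul_exp a fun i => r * spin σ i
  simp_rw [h1]
  have h2 := sum_prodWeight_mul_prod a
    fun (_ : Fin N) (e : ℤˣ) => Real.cosh (a + r * ((e : ℤ) : ℝ)) / Real.cosh a
  simp only [spin]
  rw [h2, Finset.prod_const, Finset.card_univ, Fintype.card_fin]
  have hc := Real.cosh_pos a
  have h3 : (Real.exp a * (Real.cosh (a + r * (((1 : ℤˣ) : ℤ) : ℝ)) / Real.cosh a) +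
      Real.exp (-a) * (Real.cosh (a + r * (((-1 : ℤˣ) : ℤ) : ℝ)) / Real.cosh a)) /
        (2 * Real.cosh a) = Real.cosh r + m ^ 2 * Real.sinh r := by
    have e1 : Real.exp a = Real.cosh a + Real.sinh a := (Real.cosh_add_sinh a).symm
    have e2 : Real.exp (-a) = Real.cosh a - Real.sinh a := (Real.cosh_sub_sinh a).symm
    rw [e1, e2, hm, Real.tanh_eq_sinh_div_cosh]
    simp only [Units.val_one, Int.cast_one, mul_one, Units.val_neg, Int.cast_neg, mul_neg,
      Real.cosh_add, Real.sinh_neg, Real.cosh_neg]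
    field_simp
    ring
  rw [h3]
  have hb := pow_le_pow_left₀ (a := Real.cosh r + m ^ 2 * Real.sinh r) (by
      have := Real.cosh_pos r
      have := Real.cosh_add_sinh r
      have := Real.cosh_sub_sinh r
      have := Real.exp_pos r
      have := Real.exp_pos (-r)
      have : m ^ 2 ≤ 1 := by nlinarith
      have : 0 ≤ m ^ 2 := sq_nonneg m
      nlinarith) (cosh_add_mul_sinh_le (μ := m ^ 2) (by positivity) (by nlinarith) r) N
  refine (mul_le_mul_of_nonneg_right hb (Real.exp_pos _).le).trans (le_of_eq ?_)
  rw [← Real.exp_nat_mul, ← Real.exp_add]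
  congr 1
  linear_combination (1 / 2) * hr2

/-- A sub-Gaussian variable has bounded exponential moments of its square. -/
theorem sum_exp_sq_le {ι : Type*} [Fintype ι] {w f : ι → ℝ} {k θ : ℝ}
    (hf : ∀ t, ∑ i, w i * Real.exp (t * f i) ≤ Real.exp (k * t ^ 2 / 2))
    (hθ : 0 ≤ θ) (hk : θ * k < 1) :
    ∑ i, w i * Real.exp (θ * f i ^ 2 / 2) ≤
      ∫ u, Real.exp (θ * k * u ^ 2 / 2) ∂(gaussianReal 0 1) := by
  -- Gaussian linearization: exp(θf²/2) is the mean of exp(√θ f u) for a standard normal u. After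
  -- exchanging sum and integral, the hypothesis applies with t = √θ u.
  have h1 : ∀ i, w i * Real.exp (θ * f i ^ 2 / 2) =
      ∫ u, w i * Real.exp (Real.sqrt θ * f i * u) ∂(gaussianReal 0 1) := by
    intro i
    rw [integral_const_mul]
    have := congrFun (mgf_fun_id_gaussianReal (μ := 0) (v := 1)) (Real.sqrt θ * f i)
    rw [mgf] at this
    rw [this]
    congr 2
    rw [mul_pow, Real.sq_sqrt hθ]
    simp
  simp_rw [h1]
  rw [← integral_finsetSum _ fun i _ => (integrable_exp_mul_gaussianReal _).const_mul _]
  refine integral_mono (integrable_finsetSum _ fun i _ =>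
    (integrable_exp_mul_gaussianReal _).const_mul _)
    (integrable_exp_sq_gaussianReal one_ne_zero (by simpa using hk)) fun u => ?_
  have := hf (Real.sqrt θ * u)
  rw [mul_pow, Real.sq_sqrt hθ] at this
  refine le_trans (le_of_eq ?_) (this.trans (le_of_eq ?_))
  · refine Finset.sum_congr rfl fun i _ => ?_
    ring_nf
  · ring_nf

/-! ### Independent spins: central limit theorem and exponentially weighted limits -/

/-- The law of `fluct (tanh a)` under `prodWeight a`. -/
noncomputable def fluctLaw (a : ℝ) (N : ℕ) : Measure ℝ :=
  ∑ σ : Config N, ENNReal.ofReal (prodWeight a σ) • Measure.dirac (fluct (Real.tanh a) σ)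

theorem integral_fluctLaw {E : Type*} [NormedAddCommGroup E] [NormedSpace ℝ E] [CompleteSpace E]
    (a : ℝ) (N : ℕ) (g : ℝ → E) :
    ∫ x, g x ∂(fluctLaw a N) =
      ∑ σ : Config N, prodWeight a σ • g (fluct (Real.tanh a) σ) := by
  rw [fluctLaw, integral_finsetSum_measure]
  · refine Finset.sum_congr rfl fun σ _ => ?_
    rw [integral_smul_measure, integral_dirac, ENNReal.toReal_ofReal (prodWeight_pos a σ).le]
  · exact fun σ _ => (integrable_dirac (by simp)).smul_measure ENNReal.ofReal_ne_top

instance (a : ℝ) (N : ℕ) : IsProbabilityMeasure (fluctLaw a N) := by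
  constructor
  simp only [fluctLaw, Measure.coe_finsetSum, Finset.sum_apply, Measure.smul_apply,
    measure_univ, smul_eq_mul, mul_one]
  rw [← ENNReal.ofReal_sum_of_nonneg fun σ _ => (prodWeight_pos a σ).le, sum_prodWeight,
    ENNReal.ofReal_one]

/-- The law of a single centred spin, normalized to have variance one. -/
noncomputable def spinLaw (a : ℝ) : Measure ℝ :=
  ENNReal.ofReal (Real.exp a / (2 * Real.cosh a)) •
      Measure.dirac ((1 - Real.tanh a) * Real.cosh a) +
    ENNReal.ofReal (Real.exp (-a) / (2 * Real.cosh a)) •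
      Measure.dirac ((-1 - Real.tanh a) * Real.cosh a)

theorem integral_spinLaw {E : Type*} [NormedAddCommGroup E] [NormedSpace ℝ E] [CompleteSpace E]
    (a : ℝ) (g : ℝ → E) :
    ∫ x, g x ∂(spinLaw a) =
      (Real.exp a / (2 * Real.cosh a)) • g ((1 - Real.tanh a) * Real.cosh a) +
      (Real.exp (-a) / (2 * Real.cosh a)) • g ((-1 - Real.tanh a) * Real.cosh a) := by
  have hc := Real.cosh_pos a
  rw [spinLaw, integral_add_measure, integral_smul_measure, integral_smul_measure,
    integral_dirac, integral_dirac, ENNReal.toReal_ofReal (by positivity),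
    ENNReal.toReal_ofReal (by positivity)]
  · exact (integrable_dirac (by simp)).smul_measure ENNReal.ofReal_ne_top
  · exact (integrable_dirac (by simp)).smul_measure ENNReal.ofReal_ne_top

instance (a : ℝ) : IsProbabilityMeasure (spinLaw a) := by
  have hc := Real.cosh_pos a
  constructor
  simp only [spinLaw, Measure.coe_add, Pi.add_apply, Measure.smul_apply, measure_univ,
    smul_eq_mul, mul_one]
  rw [← ENNReal.ofReal_add (by positivity) (by positivity), ← ENNReal.ofReal_one]
  congr 1
  rw [Real.cosh_eq a]
  have := Real.exp_pos a
  have := Real.exp_pos (-a)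
  field_simp

/-- A centred spin has variance 1/cosh² a, so `spinLaw` multiplies by cosh a and the argument t is
divided by it. The `map id` matches the form of the central limit theorem applied next. -/
theorem charFun_fluctLaw (a : ℝ) (N : ℕ) (t : ℝ) :
    charFun (fluctLaw a N) t =
      charFun ((spinLaw a).map id) ((Real.sqrt N)⁻¹ * (t / Real.cosh a)) ^ N := by
  have hc := (Real.cosh_pos a).ne'
  rw [Measure.map_id, charFun_apply_real, charFun_apply_real, integral_fluctLaw, integral_spinLaw]
  have h := sum_config_prod (N := N) fun _ (e : ℤˣ) =>
    (((Real.exp (a * ((e : ℤ) : ℝ)) / (2 * Real.cosh a) : ℝ) : ℂ) *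
      Complex.exp (t * ((Real.sqrt N)⁻¹ * (((e : ℤ) : ℝ) - Real.tanh a) : ℝ) * Complex.I))
  rw [Finset.prod_const, Finset.card_univ, Fintype.card_fin] at h
  have hl : ∀ σ : Config N, prodWeight a σ • Complex.exp (t * (fluct (Real.tanh a) σ : ℝ) * Complex.I)
      = ∏ i, (((Real.exp (a * ((σ i : ℤ) : ℝ)) / (2 * Real.cosh a) : ℝ) : ℂ) *
      Complex.exp (t * ((Real.sqrt N)⁻¹ * (((σ i : ℤ) : ℝ) - Real.tanh a) : ℝ) * Complex.I)) := by
    intro σ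
    rw [Finset.prod_mul_distrib, ← Complex.exp_sum, ← Complex.ofReal_prod, ← Finset.sum_mul,
      ← Finset.mul_sum, ← Complex.ofReal_sum, ← Finset.mul_sum, Finset.sum_sub_distrib]
    simp only [Finset.sum_const, Finset.card_univ, Fintype.card_fin, nsmul_eq_mul]
    rw [Complex.real_smul, fluct, one_div]
    rfl
  simp_rw [hl]
  rw [h]
  congr 1
  simp only [Units.val_one, Int.cast_one, mul_one, Units.val_neg, Int.cast_neg, mul_neg,
    Complex.real_smul]
  have e1 : ∀ x : ℝ, ((t : ℂ) * (((Real.sqrt N)⁻¹ * x : ℝ) : ℂ)) =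
      (((Real.sqrt N)⁻¹ * (t / Real.cosh a) : ℝ) : ℂ) * ((x * Real.cosh a : ℝ) : ℂ) := by
    intro x
    norm_cast
    field_simp
  rw [e1, e1]

theorem tendsto_fluctLaw (a : ℝ) (g : BoundedContinuousFunction ℝ ℝ) :
    Tendsto (fun N => ∑ σ : Config N, prodWeight a σ * g (fluct (Real.tanh a) σ)) atTop
      (𝓝 (∫ u, g u ∂(gaussianReal 0 (1 - Real.tanh a ^ 2).toNNReal))) := by
  have hc := Real.cosh_pos a
  have hcs := Real.cosh_sq a
  have e1 : Real.exp a = Real.cosh a + Real.sinh a := (Real.cosh_add_sinh a).symm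
  have e2 : Real.exp (-a) = Real.cosh a - Real.sinh a := (Real.cosh_sub_sinh a).symm
  have hs : 1 - Real.tanh a ^ 2 = 1 / Real.cosh a ^ 2 := by
    rw [Real.tanh_eq_sinh_div_cosh]
    field_simp
    linarith
  have hlim : Tendsto (β := ProbabilityMeasure ℝ) (fun N => ⟨fluctLaw a N, inferInstance⟩) atTop
      (𝓝 (⟨gaussianReal 0 (1 - Real.tanh a ^ 2).toNNReal, inferInstance⟩ : ProbabilityMeasure ℝ)) := by
    refine ProbabilityMeasure.tendsto_iff_tendsto_charFun.2 fun t => ?_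
    simp only [ProbabilityMeasure.coe_mk]
    simp_rw [charFun_fluctLaw]
    have := tendsto_charFun_inv_sqrt_mul_pow (P := spinLaw a) (X := id) aemeasurable_id
      (by
        rw [integral_spinLaw, e1, e2, Real.tanh_eq_sinh_div_cosh]
        simp only [id, smul_eq_mul]
        field_simp
        ring)
      (by
        rw [integral_spinLaw, e1, e2, Real.tanh_eq_sinh_div_cosh]
        simp only [id, smul_eq_mul, Pi.pow_apply]
        field_simp
        linear_combination (2 * Real.cosh a) * hcs)
      (t / Real.cosh a)
    convert! this using 2
    rw [charFun_gaussianReal, hs, Real.coe_toNNReal _ (by positivity)]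
    congr 1
    push_cast
    have : (Complex.cosh a) ≠ 0 := by exact_mod_cast hc.ne'
    field_simp
    simp
    ring
  have := ProbabilityMeasure.tendsto_iff_forall_integral_tendsto.1 hlim g
  simp only [ProbabilityMeasure.coe_mk] at this
  simp_rw [integral_fluctLaw] at this
  exact this

/-- Truncation error: nothing changes where u² ≤ L, and elsewhere β u² ≤ θ u² - (θ - β)L. -/
theorem abs_mul_exp_sub_mul_exp_min_le {β θ L C y u : ℝ} (hβ : 0 ≤ β) (hθ : β ≤ θ)
    (hy : |y| ≤ C) :
    |y * Real.exp (β * u ^ 2 / 2) - y * Real.exp (β * min (u ^ 2) L / 2)| ≤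
      C * Real.exp (-((θ - β) * L / 2)) * Real.exp (θ * u ^ 2 / 2) := by
  have hC : 0 ≤ C := (abs_nonneg y).trans hy
  rcases le_total (u ^ 2) L with h | h
  · rw [min_eq_left h, sub_self, abs_zero]
    positivity
  · rw [min_eq_right h, ← mul_sub, abs_mul, mul_assoc, ← Real.exp_add]
    have h1 : Real.exp (β * L / 2) ≤ Real.exp (β * u ^ 2 / 2) :=
      Real.exp_le_exp.2 (by nlinarith)
    have h2 : Real.exp (β * u ^ 2 / 2) ≤ Real.exp (-((θ - β) * L / 2) + θ * u ^ 2 / 2) :=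
      Real.exp_le_exp.2 (by nlinarith)
    have h3 := Real.exp_pos (β * L / 2)
    refine mul_le_mul hy ?_ (abs_nonneg _) hC
    rw [abs_of_nonneg (by linarith)]
    linarith

/-- Convergence of expectations of `g x * exp (β x² / 2)` for the rescaled magnetization `x` of
independent spins. -/
theorem tendsto_sum_prodWeight_mul_exp_sq {a β : ℝ} (ha : 0 < a) (hβ : 0 ≤ β)
    (hβa : β * (Real.tanh a / a) < 1) (g : BoundedContinuousFunction ℝ ℝ) :
    Tendsto (fun N => ∑ σ : Config N, prodWeight a σ *
        (g (fluct (Real.tanh a) σ) * Real.exp (β * fluct (Real.tanh a) σ ^ 2 / 2))) atTop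
      (𝓝 (∫ u, g u * Real.exp (β * u ^ 2 / 2)
        ∂(gaussianReal 0 (1 - Real.tanh a ^ 2).toNNReal))) := by
  set k := Real.tanh a / a with hk
  have hk0 : 0 < k := div_pos (tanh_pos ha) ha
  set s := 1 - Real.tanh a ^ 2 with hs
  have hs0 : 0 < s := by
    have := tanh_pos ha
    have := Real.tanh_lt_one a
    rw [hs]; nlinarith
  have hsk : s ≤ k := one_sub_tanh_sq_le ha
  -- The room between β and 1/k leaves a moment of order θ > β that is still bounded in N; it makes
  -- the truncation error small uniformly in N.
  obtain ⟨θ, hθ1, hθ2⟩ : ∃ θ, β < θ ∧ θ * k < 1 := by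
    obtain ⟨θ, h1, h2⟩ := exists_between ((lt_div_iff₀ hk0).2 hβa)
    exact ⟨θ, h1, (lt_div_iff₀ hk0).1 h2⟩
  have hθ0 : 0 < θ := lt_of_le_of_lt hβ hθ1
  set ν := gaussianReal 0 s.toNNReal with hν
  set C1 := ∫ u, Real.exp (θ * k * u ^ 2 / 2) ∂(gaussianReal 0 1) with hC1
  set C2 := ∫ u, Real.exp (θ * u ^ 2 / 2) ∂ν with hC2
  have hC1' : 0 ≤ C1 := integral_nonneg fun _ => (Real.exp_pos _).le
  have hC2' : 0 ≤ C2 := integral_nonneg fun _ => (Real.exp_pos _).le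
  have hsn : s.toNNReal ≠ 0 := by simpa using hs0
  have hint : ∀ b, b * s < 1 → Integrable (fun u => Real.exp (b * u ^ 2 / 2)) ν := fun b hb =>
    integrable_exp_sq_gaussianReal hsn (by rwa [Real.coe_toNNReal _ hs0.le])
  have hgb : ∀ u, |g u| ≤ ‖g‖ := fun u => g.norm_coe_le_norm u
  rw [Metric.tendsto_atTop]
  intro ε hε
  obtain ⟨L, hL⟩ : ∃ L, ‖g‖ * Real.exp (-((θ - β) * L / 2)) * (C1 + C2) < ε / 2 := by
    have h1 : Tendsto (fun L : ℝ => (θ - β) * L / 2) atTop atTop :=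
      (tendsto_id.const_mul_atTop (sub_pos.2 hθ1)).atTop_div_const two_pos
    have h2 := (((Real.tendsto_exp_neg_atTop_nhds_zero.comp h1).const_mul ‖g‖).mul_const (C1 + C2))
    rw [mul_zero, zero_mul] at h2
    exact (h2.eventually_lt_const (half_pos hε)).exists
  let gL : BoundedContinuousFunction ℝ ℝ := BoundedContinuousFunction.ofNormedAddCommGroup
    (fun u => g u * Real.exp (β * min (u ^ 2) L / 2)) (by fun_prop) (‖g‖ * Real.exp (β * L / 2))
    (fun u => by
      rw [norm_mul, Real.norm_eq_abs (Real.exp _), Real.abs_exp]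
      have : min (u ^ 2) L ≤ L := min_le_right _ _
      gcongr
      exact g.norm_coe_le_norm u)
  have hgL : ∀ u, gL u = g u * Real.exp (β * min (u ^ 2) L / 2) := fun u => rfl
  have hlim := Metric.tendsto_atTop.1 (tendsto_fluctLaw a gL) (ε / 2) (half_pos hε)
  obtain ⟨N0, hN0⟩ := hlim
  refine ⟨max N0 1, fun N hN => ?_⟩
  have h0 := hN0 N (le_trans (le_max_left _ _) hN)
  have hN1 : 1 ≤ N := le_trans (le_max_right _ _) hN
  set δ := ‖g‖ * Real.exp (-((θ - β) * L / 2)) with hδ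
  have hδ0 : 0 ≤ δ := by positivity
  have hpt : ∀ u, |g u * Real.exp (β * u ^ 2 / 2) - gL u| ≤ δ * Real.exp (θ * u ^ 2 / 2) :=
    fun u => abs_mul_exp_sub_mul_exp_min_le hβ hθ1.le (hgb u)
  have hA : |∑ σ : Config N, prodWeight a σ *
        (g (fluct (Real.tanh a) σ) * Real.exp (β * fluct (Real.tanh a) σ ^ 2 / 2)) -
      ∑ σ : Config N, prodWeight a σ * gL (fluct (Real.tanh a) σ)| ≤ δ * C1 := by
    rw [← Finset.sum_sub_distrib]
    refine (Finset.abs_sum_le_sum_abs _ _).trans ?_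
    have hmom := sum_exp_sq_le (w := fun σ : Config N => prodWeight a σ)
      (f := fun σ => fluct (Real.tanh a) σ)
      (sum_prodWeight_mul_exp_fluct_le ha hN1) hθ0.le hθ2
    refine le_trans ?_ (mul_le_mul_of_nonneg_left hmom hδ0)
    rw [Finset.mul_sum]
    refine Finset.sum_le_sum fun σ _ => ?_
    have hw := prodWeight_pos a σ
    rw [← mul_sub, abs_mul, abs_of_pos hw]
    nlinarith [mul_le_mul_of_nonneg_left (hpt (fluct (Real.tanh a) σ)) hw.le]
  have hB : |∫ u, gL u ∂ν - ∫ u, g u * Real.exp (β * u ^ 2 / 2) ∂ν| ≤ δ * C2 := by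
    have hi : Integrable (fun u => g u * Real.exp (β * u ^ 2 / 2)) ν :=
      (hint β (by nlinarith)).bdd_mul (c := ‖g‖) g.continuous.aestronglyMeasurable
        (ae_of_all _ fun u => g.norm_coe_le_norm u)
    rw [← integral_sub (gL.integrable ν) hi, hC2, ← integral_const_mul]
    refine abs_integral_le_integral_abs.trans
      (integral_mono ((gL.integrable ν).sub hi).abs
        ((hint θ (by nlinarith)).const_mul δ) fun u => ?_)
    show |gL u - g u * Real.exp (β * u ^ 2 / 2)| ≤ _
    rw [abs_sub_comm]
    exact hpt u
  rw [Real.dist_eq] at h0 ⊢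
  have h3 := abs_sub_le (∑ σ : Config N, prodWeight a σ *
        (g (fluct (Real.tanh a) σ) * Real.exp (β * fluct (Real.tanh a) σ ^ 2 / 2)))
    (∑ σ : Config N, prodWeight a σ * gL (fluct (Real.tanh a) σ))
    (∫ u, g u * Real.exp (β * u ^ 2 / 2) ∂ν)
  have h4 := abs_sub_le (∑ σ : Config N, prodWeight a σ * gL (fluct (Real.tanh a) σ))
    (∫ u, gL u ∂ν) (∫ u, g u * Real.exp (β * u ^ 2 / 2) ∂ν)
  have h5 : |∑ σ : Config N, prodWeight a σ * gL (fluct (Real.tanh a) σ) - ∫ u, gL u ∂ν| < ε / 2 :=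
    h0
  nlinarith

/-! ### Exponential moments of the edge indicators -/

namespace IsErdosRenyi

variable {Ω : Type*} [MeasurableSpace Ω] {P : Measure Ω} {N : ℕ} {p : ℝ}
  {ε : Fin N → Fin N → Ω → ℝ}

theorem measurable_exp_sum (hε : IsErdosRenyi P N p ε) (c : Fin N → Fin N → ℝ) :
    Measurable fun ω => Real.exp (∑ i, ∑ j, c i j * (ε i j ω - p)) := by
  have := hε.measurable
  fun_prop

variable [IsProbabilityMeasure P]

theorem ae_zero_or_one (hε : IsErdosRenyi P N p ε) (hp0 : 0 ≤ p) (hp1 : p ≤ 1) (i j : Fin N) :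
    ∀ᵐ ω ∂P, ε i j ω = 0 ∨ ε i j ω = 1 := by
  have m0 : MeasurableSet {ω | ε i j ω = 0} := hε.measurable i j (measurableSet_singleton 0)
  have m1 : MeasurableSet {ω | ε i j ω = 1} := hε.measurable i j (measurableSet_singleton 1)
  have hd : Disjoint {ω | ε i j ω = 0} {ω | ε i j ω = 1} := by
    rw [Set.disjoint_left]
    intro ω h0 h1
    simp only [Set.mem_ofPred_eq] at h0 h1
    linarith
  have hu := measure_union (μ := P) hd m1
  rw [hε.prob_one, hε.prob_zero, ← ENNReal.ofReal_add (by linarith) hp0, sub_add_cancel,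
    ENNReal.ofReal_one] at hu
  exact (prob_compl_eq_zero_iff (m0.union m1)).2 hu

theorem integral_comp (hε : IsErdosRenyi P N p ε) (hp0 : 0 ≤ p) (hp1 : p ≤ 1) (i j : Fin N)
    (f : ℝ → ℝ) : ∫ ω, f (ε i j ω) ∂P = (1 - p) * f 0 + p * f 1 := by
  have m0 : MeasurableSet {ω | ε i j ω = 0} := hε.measurable i j (measurableSet_singleton 0)
  have m1 : MeasurableSet {ω | ε i j ω = 1} := hε.measurable i j (measurableSet_singleton 1)
  have hae : (fun ω => f (ε i j ω)) =ᵐ[P] fun ω =>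
      {ω | ε i j ω = 0}.indicator (fun _ => f 0) ω +
        {ω | ε i j ω = 1}.indicator (fun _ => f 1) ω := by
    filter_upwards [hε.ae_zero_or_one hp0 hp1 i j] with ω hω
    rcases hω with h | h <;> simp [h]
  rw [integral_congr_ae hae, integral_add ((integrable_const _).indicator m0)
    ((integrable_const _).indicator m1), integral_indicator_const _ m0,
    integral_indicator_const _ m1, measureReal_def, measureReal_def, hε.prob_one, hε.prob_zero,
    ENNReal.toReal_ofReal (by linarith), ENNReal.toReal_ofReal hp0]
  simp

theorem integrable_exp_sum (hε : IsErdosRenyi P N p ε) (hp0 : 0 ≤ p) (hp1 : p ≤ 1)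
    (c : Fin N → Fin N → ℝ) :
    Integrable (fun ω => Real.exp (∑ i, ∑ j, c i j * (ε i j ω - p))) P := by
  have hall : ∀ᵐ ω ∂P, ∀ i j, ε i j ω = 0 ∨ ε i j ω = 1 :=
    ae_all_iff.2 fun i => ae_all_iff.2 fun j => hε.ae_zero_or_one hp0 hp1 i j
  refine Integrable.of_bound (hε.measurable_exp_sum c).aestronglyMeasurable
    (Real.exp (∑ i, ∑ j, |c i j|)) ?_
  filter_upwards [hall] with ω hω
  rw [Real.norm_eq_abs, Real.abs_exp, Real.exp_le_exp]
  refine Finset.sum_le_sum fun i _ => Finset.sum_le_sum fun j _ => ?_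
  refine (le_abs_self _).trans ?_
  rw [abs_mul]
  refine mul_le_of_le_one_right (abs_nonneg _) ?_
  rw [abs_le]
  rcases hω i j with h | h <;> rw [h] <;> constructor <;> linarith

theorem integral_exp_sum (hε : IsErdosRenyi P N p ε) (hp0 : 0 ≤ p) (hp1 : p ≤ 1)
    (c : Fin N → Fin N → ℝ) {δ : ℝ} (hδ : δ ≤ 1 / 2) (hc : ∀ i j, |c i j| ≤ δ) :
    ∃ e, |e| ≤ 2 * (p * δ ^ 3) * N ^ 2 ∧
      ∫ ω, Real.exp (∑ i, ∑ j, c i j * (ε i j ω - p)) ∂P =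
        Real.exp (p * (1 - p) / 2 * ∑ i, ∑ j, c i j ^ 2 + e) := by
  choose e he1 he2 using fun q : Fin N × Fin N =>
    bernoulli_laplace hp0 hp1 ((hc q.1 q.2).trans hδ)
  refine ⟨∑ q, e q, ?_, ?_⟩
  · refine (Finset.abs_sum_le_sum_abs _ _).trans
      ((Finset.sum_le_card_nsmul _ _ (2 * (p * δ ^ 3)) fun q _ => (he1 q).trans ?_).trans
        (le_of_eq ?_))
    · have := hc q.1 q.2
      gcongr
    · simp [sq]
      ring
  · have h1 : ∀ ω, Real.exp (∑ i, ∑ j, c i j * (ε i j ω - p)) =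
        ∏ q : Fin N × Fin N, Real.exp (c q.1 q.2 * (ε q.1 q.2 ω - p)) := by
      intro ω
      rw [← Real.exp_sum, Fintype.sum_prod_type]
    simp_rw [h1]
    have h3 := hε.indep.integral_fun_prod_comp
      (f := fun (q : Fin N × Fin N) (x : ℝ) => Real.exp (c q.1 q.2 * (x - p)))
      (fun q => (hε.measurable q.1 q.2).aemeasurable)
      (fun q => (by fun_prop : Measurable _).aestronglyMeasurable)
    rw [h3]
    have h2 : ∀ q : Fin N × Fin N, ∫ ω, Real.exp (c q.1 q.2 * (ε q.1 q.2 ω - p)) ∂P =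
        Real.exp (p * (1 - p) * c q.1 q.2 ^ 2 / 2 + e q) := fun q => by
      rw [← he2 q]
      exact hε.integral_comp hp0 hp1 q.1 q.2 fun x => Real.exp (c q.1 q.2 * (x - p))
    simp_rw [h2]
    rw [← Real.exp_sum, Finset.sum_add_distrib, ← Fintype.sum_prod_type'
      (fun i j => c i j ^ 2), Finset.mul_sum]
    congr 2
    refine Finset.sum_congr rfl fun q _ => ?_
    ring

end IsErdosRenyi

/-! ### Small perturbations of the weights and uniform moment bounds -/

/-- Convexity of exp between 0 and δA, at the point ηA. The result is linear in η, at the cost of an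
exponential moment of fixed order δ. -/
theorem abs_exp_sub_one_le_mul_exp {δ η A Φ : ℝ} (hδ : 0 < δ) (hη0 : 0 ≤ η) (hη : η ≤ δ)
    (hΦ : |Φ| ≤ η * A) : |Real.exp Φ - 1| ≤ η / δ * Real.exp (δ * A) := by
  have h1 : |Real.exp Φ - 1| ≤ Real.exp |Φ| - 1 := by
    have h2 := Real.exp_pos |Φ|
    have h3 : Real.exp Φ ≤ Real.exp |Φ| := Real.exp_le_exp.2 (le_abs_self _)
    have h4 : Real.exp (-|Φ|) ≤ Real.exp Φ := Real.exp_le_exp.2 (neg_abs_le _)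
    have h5 := Real.add_one_le_exp (-|Φ|)
    have h6 := Real.add_one_le_exp |Φ|
    rw [abs_le]
    constructor <;> linarith
  have ht0 : 0 ≤ η / δ := by positivity
  have ht1 : 0 ≤ 1 - η / δ := by rw [sub_nonneg, div_le_one hδ]; exact hη
  have h2 := convexOn_exp.2 (Set.mem_univ (δ * A)) (Set.mem_univ 0) ht0 ht1 (by ring)
  simp only [smul_eq_mul, mul_zero, add_zero, Real.exp_zero, mul_one] at h2
  have h3 : Real.exp |Φ| ≤ Real.exp (η / δ * (δ * A)) := by
    rw [Real.exp_le_exp, ← mul_assoc, div_mul_cancel₀ _ hδ.ne']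
    exact hΦ
  linarith

/-- A small multiplicative perturbation does not change a weighted sum by much. -/
theorem abs_sum_mul_exp_sub_sum_le {ι : Type*} [Fintype ι] {w F V A Φ : ι → ℝ} {B C δ η : ℝ}
    (hw : ∀ i, 0 ≤ w i) (hB : 0 ≤ B) (hF : ∀ i, |F i| ≤ B * V i) (hδ : 0 < δ) (hη0 : 0 ≤ η)
    (hη : η ≤ δ) (hΦ : ∀ i, |Φ i| ≤ η * A i)
    (hC : ∑ i, w i * (V i * Real.exp (δ * A i)) ≤ C) :
    |∑ i, w i * (F i * Real.exp (Φ i)) - ∑ i, w i * F i| ≤ B / δ * C * η := by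
  rw [← Finset.sum_sub_distrib]
  refine (Finset.abs_sum_le_sum_abs _ _).trans ?_
  calc _ ≤ ∑ i, B / δ * η * (w i * (V i * Real.exp (δ * A i))) := by
        refine Finset.sum_le_sum fun i _ => ?_
        have h := mul_le_mul (hF i) (abs_exp_sub_one_le_mul_exp hδ hη0 hη (hΦ i))
          (abs_nonneg _) ((abs_nonneg _).trans (hF i))
        rw [← abs_mul] at h
        have h2 := mul_le_mul_of_nonneg_left h (hw i)
        rw [← mul_sub, abs_mul, abs_of_nonneg (hw i), ← mul_sub_one]
        refine h2.trans (le_of_eq ?_)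
        ring
    _ = B / δ * η * ∑ i, w i * (V i * Real.exp (δ * A i)) := by rw [Finset.mul_sum]
    _ ≤ B / δ * η * C := by gcongr
    _ = _ := by ring

/-- Uniform exponential moments of the two magnetizations and of the overlap of two independent
replicas. -/
theorem exists_exp_moment_bound {a β : ℝ} (ha : 0 < a) (hβ : 0 < β)
    (hβa : β * (Real.tanh a / a) < 1) :
    ∃ δ > 0, ∃ C, ∀ N : ℕ, 1 ≤ N →
      (∑ σ : Config N, prodWeight a σ * (Real.exp (β * fluct (Real.tanh a) σ ^ 2 / 2) *
        Real.exp (δ * (1 + fluct (Real.tanh a) σ ^ 2))) ≤ C) ∧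
      (∑ q : Config N × Config N, prodWeight a q.1 * prodWeight a q.2 *
        (Real.exp (β * fluct (Real.tanh a) q.1 ^ 2 / 2) *
          Real.exp (β * fluct (Real.tanh a) q.2 ^ 2 / 2) *
        Real.exp (δ * (1 + fluct (Real.tanh a) q.1 ^ 2 + fluct (Real.tanh a) q.2 ^ 2 +
          fluct (Real.tanh a ^ 2) (q.1 * q.2) ^ 2))) ≤ C) := by
  set k := Real.tanh a / a with hk
  have hk0 : 0 < k := div_pos (tanh_pos ha) ha
  obtain ⟨θ, hθ1, hθ2⟩ : ∃ θ, β < θ ∧ θ * k < 1 := by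
    obtain ⟨θ, h1, h2⟩ := exists_between ((lt_div_iff₀ hk0).2 hβa)
    exact ⟨θ, h1, (lt_div_iff₀ hk0).1 h2⟩
  -- The overlap depends on both magnetizations, so its factor is split off by a convex combination
  -- with weights 1/(1 + κ) and κ/(1 + κ). This κ spends half of the gap θ - β, and δ is small
  -- enough to fit in what remains and in the overlap's own moment.
  set κ := (θ - β) / (2 * β) with hκ
  have hκ0 : 0 < κ := div_pos (by linarith) (by linarith)
  have hκβ : κ * β = (θ - β) / 2 := by rw [hκ]; field_simp
  set δ := min ((θ - β) / (4 * (1 + κ))) (κ / (4 * (1 + κ))) with hδ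
  have hδ0 : 0 < δ := lt_min (div_pos (by linarith) (by linarith)) (div_pos hκ0 (by linarith))
  have hd1 : δ * (4 * (1 + κ)) ≤ θ - β := by
    rw [← le_div_iff₀ (by linarith)]; exact min_le_left _ _
  have hd2 : δ * (4 * (1 + κ)) ≤ κ := by
    rw [← le_div_iff₀ (by linarith)]; exact min_le_right _ _
  set C1 := ∫ u, Real.exp (θ * k * u ^ 2 / 2) ∂(gaussianReal 0 1) with hC1
  set C2 := ∫ u, Real.exp (1 / 2 * 1 * u ^ 2 / 2) ∂(gaussianReal 0 1) with hC2
  have hC1' : 0 ≤ C1 := integral_nonneg fun _ => (Real.exp_pos _).le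
  have hC2' : 0 ≤ C2 := integral_nonneg fun _ => (Real.exp_pos _).le
  refine ⟨δ, hδ0, Real.exp δ * (C1 + C1 ^ 2 + C2), fun N hN => ?_⟩
  have hmom : ∑ σ : Config N, prodWeight a σ *
      Real.exp (θ * fluct (Real.tanh a) σ ^ 2 / 2) ≤ C1 :=
    sum_exp_sq_le (sum_prodWeight_mul_exp_fluct_le ha hN) (hβ.trans hθ1).le hθ2
  have hmom0 : 0 ≤ ∑ σ : Config N, prodWeight a σ *
      Real.exp (θ * fluct (Real.tanh a) σ ^ 2 / 2) :=
    Finset.sum_nonneg fun σ _ => mul_nonneg (prodWeight_pos a σ).le (Real.exp_pos _).le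
  have hmom2 : ∑ q : Config N × Config N, prodWeight a q.1 * prodWeight a q.2 *
      Real.exp (1 / 2 * fluct (Real.tanh a ^ 2) (q.1 * q.2) ^ 2 / 2) ≤ C2 :=
    sum_exp_sq_le (w := fun q : Config N × Config N => prodWeight a q.1 * prodWeight a q.2)
      (sum_prodWeight_mul_exp_overlap_le ha hN) (by norm_num) (by norm_num)
  constructor
  · calc _ ≤ ∑ σ : Config N, Real.exp δ * (prodWeight a σ *
          Real.exp (θ * fluct (Real.tanh a) σ ^ 2 / 2)) := by
          refine Finset.sum_le_sum fun σ _ => ?_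
          rw [mul_left_comm (Real.exp δ)]
          refine mul_le_mul_of_nonneg_left ?_ (prodWeight_pos a σ).le
          rw [← Real.exp_add, ← Real.exp_add, Real.exp_le_exp]
          nlinarith [sq_nonneg (fluct (Real.tanh a) σ), mul_pos hδ0 hκ0]
      _ ≤ Real.exp δ * C1 := by
          rw [← Finset.mul_sum]
          exact mul_le_mul_of_nonneg_left hmom (Real.exp_pos _).le
      _ ≤ _ := by
          refine mul_le_mul_of_nonneg_left ?_ (Real.exp_pos _).le
          nlinarith [sq_nonneg C1]
  · have hpt : ∀ x y w : ℝ, Real.exp (β * x ^ 2 / 2) * Real.exp (β * y ^ 2 / 2) *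
        Real.exp (δ * (1 + x ^ 2 + y ^ 2 + w ^ 2)) ≤
        Real.exp δ * (Real.exp (θ * x ^ 2 / 2) * Real.exp (θ * y ^ 2 / 2) +
          Real.exp (1 / 2 * w ^ 2 / 2)) := by
      intro x y w
      have hq : (1 + κ) * (β / 2 + δ) ≤ θ / 2 := by nlinarith
      have hw : (1 + κ) * δ ≤ κ / 4 := by linarith
      rw [← Real.exp_add, ← Real.exp_add, ← Real.exp_add]
      have hz : β * x ^ 2 / 2 + β * y ^ 2 / 2 + δ * (1 + x ^ 2 + y ^ 2 + w ^ 2) =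
          δ + ((β / 2 + δ) * (x ^ 2 + y ^ 2) + δ * w ^ 2) := by ring
      rw [hz, Real.exp_add]
      refine mul_le_mul_of_nonneg_left ?_ (Real.exp_pos _).le
      have hX : (1 + κ) * ((β / 2 + δ) * (x ^ 2 + y ^ 2)) ≤ θ * x ^ 2 / 2 + θ * y ^ 2 / 2 := by
        nlinarith [sq_nonneg x, sq_nonneg y]
      have hW : (1 + κ) * (δ * w ^ 2) ≤ κ * (1 / 2 * w ^ 2 / 2) := by
        nlinarith [sq_nonneg w]
      -- By `hX` and `hW` the exponent is at most a convex combination of the two exponents on the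
      -- right, hence at most the larger one; the sum of exponentials dominates both cases.
      rcases le_total (θ * x ^ 2 / 2 + θ * y ^ 2 / 2) (1 / 2 * w ^ 2 / 2) with h | h
      · have : (β / 2 + δ) * (x ^ 2 + y ^ 2) + δ * w ^ 2 ≤ 1 / 2 * w ^ 2 / 2 := by
          refine le_of_mul_le_mul_left ?_ (by linarith : 0 < 1 + κ)
          nlinarith
        have := Real.exp_le_exp.2 this
        have := Real.exp_pos (θ * x ^ 2 / 2 + θ * y ^ 2 / 2)
        linarith
      · have : (β / 2 + δ) * (x ^ 2 + y ^ 2) + δ * w ^ 2 ≤ θ * x ^ 2 / 2 + θ * y ^ 2 / 2 := by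
          refine le_of_mul_le_mul_left ?_ (by linarith : 0 < 1 + κ)
          nlinarith
        have := Real.exp_le_exp.2 this
        have := Real.exp_pos (1 / 2 * w ^ 2 / 2)
        linarith
    calc _ ≤ ∑ q : Config N × Config N, Real.exp δ * (
          (prodWeight a q.1 * Real.exp (θ * fluct (Real.tanh a) q.1 ^ 2 / 2)) *
            (prodWeight a q.2 * Real.exp (θ * fluct (Real.tanh a) q.2 ^ 2 / 2)) +
          prodWeight a q.1 * prodWeight a q.2 *
            Real.exp (1 / 2 * fluct (Real.tanh a ^ 2) (q.1 * q.2) ^ 2 / 2)) := by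
          refine Finset.sum_le_sum fun q _ => ?_
          refine (mul_le_mul_of_nonneg_left (hpt _ _ _)
            (mul_pos (prodWeight_pos a q.1) (prodWeight_pos a q.2)).le).trans (le_of_eq ?_)
          ring
      _ ≤ Real.exp δ * (C1 ^ 2 + C2) := by
          rw [← Finset.mul_sum, Finset.sum_add_distrib, Fintype.sum_prod_type]
          dsimp only
          rw [← Fintype.sum_mul_sum, ← sq]
          gcongr
      _ ≤ _ := by
          refine mul_le_mul_of_nonneg_left ?_ (Real.exp_pos _).le
          linarith

/-! ### Expected edge factors for one and two replicas -/

theorem sum_spin_eq {m : ℝ} {N : ℕ} (hN : 1 ≤ N) (σ : Config N) :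
    ∑ i, spin σ i = N * m + Real.sqrt N * fluct m σ := by
  have : (0 : ℝ) < Real.sqrt N := Real.sqrt_pos.2 (by exact_mod_cast hN)
  rw [fluct]
  field_simp
  ring

theorem sum_sum_spin_mul {N : ℕ} (σ : Config N) :
    ∑ i, ∑ j, spin σ i * spin σ j = (∑ i, spin σ i) ^ 2 := by
  rw [sq, Fintype.sum_mul_sum]

/-- The coefficient of a centred edge indicator in the exponent of the Gibbs weight. -/
noncomputable def edgeCoeff (γ m : ℝ) {N : ℕ} (σ : Config N) (i j : Fin N) : ℝ :=
  γ * (spin σ i * spin σ j - m ^ 2)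

theorem abs_edgeCoeff_le {γ m : ℝ} (hγ : 0 ≤ γ) (hm : m ^ 2 ≤ 1) {N : ℕ} (σ : Config N)
    (i j : Fin N) : |edgeCoeff γ m σ i j| ≤ 2 * γ := by
  have h1 := abs_sub (spin σ i * spin σ j) (m ^ 2)
  rw [abs_mul (spin σ i), abs_spin, abs_spin, abs_of_nonneg (sq_nonneg m)] at h1
  rw [edgeCoeff, abs_mul, abs_of_nonneg hγ]
  nlinarith

theorem sum_edgeCoeff_sq {γ m : ℝ} {N : ℕ} (σ : Config N) :
    ∑ i, ∑ j, edgeCoeff γ m σ i j ^ 2 =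
      γ ^ 2 * (N ^ 2 * (1 + m ^ 4) - 2 * m ^ 2 * (∑ i, spin σ i) ^ 2) := by
  have h : ∀ i j, edgeCoeff γ m σ i j ^ 2 =
      γ ^ 2 * ((1 + m ^ 4) - 2 * m ^ 2 * (spin σ i * spin σ j)) := by
    intro i j
    rw [edgeCoeff]
    linear_combination γ ^ 2 * spin σ j ^ 2 * spin_sq σ i + γ ^ 2 * spin_sq σ j
  simp_rw [h, ← Finset.mul_sum, Finset.sum_sub_distrib, ← Finset.mul_sum, ← Finset.sum_mul]
  simp only [Finset.sum_const, Finset.card_univ, Fintype.card_fin, nsmul_eq_mul]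
  ring

/-- The cross term gives the square of the overlap sum. At magnetizations Nm and overlap Nm² the
cross terms cancel, since m⁴ - 2m⁴ + m⁴ = 0, leaving 2γ²N²(1 - m⁴), exactly twice the one-replica
value. This is why the leading covariance vanishes. -/
theorem sum_edgeCoeff_add_sq {γ m : ℝ} {N : ℕ} (σ τ : Config N) :
    ∑ i, ∑ j, (edgeCoeff γ m σ i j + edgeCoeff γ m τ i j) ^ 2 =
      γ ^ 2 * (2 * N ^ 2 * (1 + 2 * m ^ 4) - 4 * m ^ 2 * ((∑ i, spin σ i) ^ 2 +
        (∑ i, spin τ i) ^ 2) + 2 * (∑ i, spin (σ * τ) i) ^ 2) := by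
  have h : ∀ i j, (edgeCoeff γ m σ i j + edgeCoeff γ m τ i j) ^ 2 =
      edgeCoeff γ m σ i j ^ 2 + edgeCoeff γ m τ i j ^ 2 + γ ^ 2 * (2 * m ^ 4 -
        2 * m ^ 2 * (spin σ i * spin σ j) - 2 * m ^ 2 * (spin τ i * spin τ j) +
        2 * (spin (σ * τ) i * spin (σ * τ) j)) := by
    intro i j
    simp only [edgeCoeff, spin_mul]
    ring
  simp_rw [h, Finset.sum_add_distrib, sum_edgeCoeff_sq, ← Finset.mul_sum, Finset.sum_add_distrib,
    Finset.sum_sub_distrib, ← Finset.mul_sum, ← Finset.sum_mul]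
  simp
  ring

theorem abs_two_mul_add_sq_div_le {c q : ℝ} (hc : |c| ≤ 1) (hq : 1 ≤ q) (x : ℝ) :
    |2 * c * x + x ^ 2 / q| ≤ 1 + 2 * x ^ 2 := by
  have h3 : |c * x| ≤ |x| := by rw [abs_mul]; exact mul_le_of_le_one_left (abs_nonneg x) hc
  have h4 : x ^ 2 / q ≤ x ^ 2 := div_le_self (sq_nonneg x) hq
  have h5 : 0 ≤ x ^ 2 / q := by positivity
  have h6 : 2 * |x| ≤ 1 + x ^ 2 := by nlinarith [sq_nonneg (|x| - 1), sq_abs x]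
  have h7 := abs_le.1 h3
  rw [abs_le]
  constructor <;> linarith [h7.1, h7.2]

theorem abs_sq_mul_two_mul_add_sq_div_le {m q : ℝ} (hm : |m| ≤ 1) (hq : 1 ≤ q) (x : ℝ) :
    |m ^ 2 * (2 * m * x + x ^ 2 / q)| ≤ 1 + 2 * x ^ 2 := by
  have hm2 : m ^ 2 ≤ 1 := by rw [← sq_abs]; exact pow_le_one₀ (abs_nonneg m) hm
  rw [abs_mul, abs_of_nonneg (sq_nonneg m)]
  have h := mul_le_mul hm2 (abs_two_mul_add_sq_div_le hm hq x) (abs_nonneg _) zero_le_one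
  rwa [one_mul] at h

section Moments

variable {Ω : Type*} [MeasurableSpace Ω] {P : Measure Ω} [IsProbabilityMeasure P] {N : ℕ}
  {β p m : ℝ} {ε : Fin N → Fin N → Ω → ℝ}

/-- The leading order of the logarithm of the expected weight. -/
noncomputable def logMean (β p m : ℝ) (N : ℕ) : ℝ :=
  p * (1 - p) * (β / (2 * N * p)) ^ 2 * N ^ 2 * (1 - m ^ 4) / 2

/-- The order of the corrections to `logMean`. -/
noncomputable def meanError (β p : ℝ) (N : ℕ) : ℝ :=
  5 / 4 * β ^ 2 * (1 / (p * Real.sqrt N)) + 16 * β ^ 3 * (1 / (p * Real.sqrt N)) ^ 2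

theorem meanError_nonneg (hβ : 0 < β) (hp : 0 < p) : 0 ≤ meanError β p N := by
  unfold meanError
  positivity

theorem coeff_sq_eq (hN : 1 ≤ N) (hp0 : 0 < p) :
    p * (β / (2 * N * p)) ^ 2 * Real.sqrt N ^ 3 = β ^ 2 / 4 * (1 / (p * Real.sqrt N)) := by
  have hq : (0 : ℝ) < Real.sqrt N := Real.sqrt_pos.2 (by exact_mod_cast hN)
  have hq2 : (N : ℝ) = Real.sqrt N ^ 2 := (Real.sq_sqrt (Nat.cast_nonneg N)).symm
  set q := Real.sqrt N
  rw [hq2]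
  field_simp
  norm_num

theorem coeff_cube_eq (hN : 1 ≤ N) (hp0 : 0 < p) :
    2 * (p * (4 * (β / (2 * N * p))) ^ 3) * N ^ 2 = 16 * β ^ 3 * (1 / (p * Real.sqrt N)) ^ 2 := by
  have hq : (0 : ℝ) < Real.sqrt N := Real.sqrt_pos.2 (by exact_mod_cast hN)
  have hq2 : (N : ℝ) = Real.sqrt N ^ 2 := (Real.sq_sqrt (Nat.cast_nonneg N)).symm
  set q := Real.sqrt N
  rw [hq2]
  field_simp
  ring

theorem IsErdosRenyi.expect_weight (hε : IsErdosRenyi P N p ε) (hN : 1 ≤ N) (hp0 : 0 < p)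
    (hp1 : p ≤ 1) (hβ : 0 < β) (hm : |m| ≤ 1) (hγ : 4 * (β / (2 * N * p)) ≤ 1 / 2)
    (σ : Config N) :
    ∃ Φ, |Φ| ≤ meanError β p N * (1 + fluct m σ ^ 2) ∧
      ∫ ω, Real.exp (∑ i, ∑ j, edgeCoeff (β / (2 * N * p)) m σ i j * (ε i j ω - p)) ∂P =
        Real.exp (logMean β p m N) * Real.exp Φ := by
  have hm2 : m ^ 2 ≤ 1 := by rw [← sq_abs]; exact pow_le_one₀ (abs_nonneg m) hm
  have hq1 : 1 ≤ Real.sqrt N := Real.one_le_sqrt.2 (by exact_mod_cast hN)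
  have hq2 : (N : ℝ) = Real.sqrt N ^ 2 := (Real.sq_sqrt (Nat.cast_nonneg N)).symm
  have hc2 := coeff_sq_eq (β := β) hN hp0
  have hc3 := coeff_cube_eq (β := β) hN hp0
  have hγ0 : 0 ≤ β / (2 * N * p) := by positivity
  obtain ⟨e, he, hint⟩ := hε.integral_exp_sum hp0.le hp1
    (edgeCoeff (β / (2 * N * p)) m σ) hγ fun i j =>
      (abs_edgeCoeff_le hγ0 hm2 σ i j).trans (by linarith)
  rw [hc3] at he
  have hlm : logMean β p m N = p * (1 - p) * (β / (2 * N * p)) ^ 2 * N ^ 2 * (1 - m ^ 4) / 2 := rfl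
  set γ := β / (2 * N * p)
  set x := fluct m σ with hx
  set q := Real.sqrt N with hq
  -- What is left of half the edge variance times ∑ cᵢⱼ² once (Nm + √N x)² is expanded and its N²
  -- part is put into `logMean`, together with the cubic Laplace error.
  refine ⟨-(p * γ ^ 2 * q ^ 3) * ((1 - p) * (m ^ 2 * (2 * m * x + x ^ 2 / q))) + e, ?_, ?_⟩
  · rw [hc2]
    have h1 := abs_sq_mul_two_mul_add_sq_div_le hm hq1 x
    have hp' : |1 - p| ≤ 1 := by rw [abs_of_nonneg (by linarith)]; linarith
    have h9 : |(1 - p) * (m ^ 2 * (2 * m * x + x ^ 2 / q))| ≤ 1 * (1 + 2 * x ^ 2) := by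
      rw [abs_mul]
      exact mul_le_mul hp' h1 (abs_nonneg _) zero_le_one
    refine (abs_add_le _ _).trans ?_
    have hr : 0 ≤ β ^ 2 / 4 * (1 / (p * q)) := by positivity
    rw [abs_mul, abs_neg, abs_of_nonneg hr, meanError, ← hq]
    have h10 := mul_le_mul_of_nonneg_left h9 hr
    have hr2 : 0 ≤ 16 * β ^ 3 * (1 / (p * q)) ^ 2 := by positivity
    have hT : 1 * (1 + 2 * x ^ 2) ≤ 5 * (1 + x ^ 2) := by linarith [sq_nonneg x]
    have hT1 : 1 ≤ 1 + x ^ 2 := by linarith [sq_nonneg x]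
    refine (add_le_add (h10.trans (mul_le_mul_of_nonneg_left hT hr))
      (he.trans (le_mul_of_one_le_right hr2 hT1))).trans (le_of_eq ?_)
    ring
  · rw [hint, ← Real.exp_add, sum_edgeCoeff_sq, sum_spin_eq (m := m) hN, hlm]
    congr 1
    rw [← hx, ← hq, hq2]
    have : q ≠ 0 := by positivity
    field_simp
    ring

theorem IsErdosRenyi.expect_weight_pair (hε : IsErdosRenyi P N p ε) (hN : 1 ≤ N) (hp0 : 0 < p)
    (hp1 : p ≤ 1) (hβ : 0 < β) (hm : |m| ≤ 1) (hγ : 4 * (β / (2 * N * p)) ≤ 1 / 2)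
    (σ τ : Config N) :
    ∃ Φ, |Φ| ≤ meanError β p N *
        (1 + fluct m σ ^ 2 + fluct m τ ^ 2 + fluct (m ^ 2) (σ * τ) ^ 2) ∧
      ∫ ω, Real.exp (∑ i, ∑ j, (edgeCoeff (β / (2 * N * p)) m σ i j +
          edgeCoeff (β / (2 * N * p)) m τ i j) * (ε i j ω - p)) ∂P =
        Real.exp (logMean β p m N) ^ 2 * Real.exp Φ := by
  have hm2 : m ^ 2 ≤ 1 := by rw [← sq_abs]; exact pow_le_one₀ (abs_nonneg m) hm
  have hq1 : 1 ≤ Real.sqrt N := Real.one_le_sqrt.2 (by exact_mod_cast hN)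
  have hq2 : (N : ℝ) = Real.sqrt N ^ 2 := (Real.sq_sqrt (Nat.cast_nonneg N)).symm
  have hc2 := coeff_sq_eq (β := β) hN hp0
  have hc3 := coeff_cube_eq (β := β) hN hp0
  have hγ0 : 0 ≤ β / (2 * N * p) := by positivity
  obtain ⟨e, he, hint⟩ := hε.integral_exp_sum hp0.le hp1
    (fun i j => edgeCoeff (β / (2 * N * p)) m σ i j + edgeCoeff (β / (2 * N * p)) m τ i j)
    hγ fun i j => (abs_add_le _ _).trans (by
      have := abs_edgeCoeff_le hγ0 hm2 σ i j
      have := abs_edgeCoeff_le hγ0 hm2 τ i j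
      linarith)
  rw [hc3] at he
  have hlm : logMean β p m N = p * (1 - p) * (β / (2 * N * p)) ^ 2 * N ^ 2 * (1 - m ^ 4) / 2 := rfl
  set γ := β / (2 * N * p)
  set x := fluct m σ with hx
  set y := fluct m τ with hy
  set w := fluct (m ^ 2) (σ * τ) with hw
  set q := Real.sqrt N with hq
  -- Only deviations from the typical magnetizations and overlap remain in `R`. Its bound is where
  -- the 5 in `meanError` comes from.
  set R := -2 * (m ^ 2 * (2 * m * x + x ^ 2 / q)) - 2 * (m ^ 2 * (2 * m * y + y ^ 2 / q)) +
    (2 * m ^ 2 * w + w ^ 2 / q) with hR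
  refine ⟨(p * γ ^ 2 * q ^ 3) * ((1 - p) * R) + e, ?_, ?_⟩
  · rw [hc2]
    have hw1 := abs_two_mul_add_sq_div_le (c := m ^ 2)
      (by rwa [abs_of_nonneg (sq_nonneg m)]) hq1 w
    have h1 : |R| ≤ 5 + 4 * x ^ 2 + 4 * y ^ 2 + 2 * w ^ 2 := by
      have hx1 := abs_le.1 (abs_sq_mul_two_mul_add_sq_div_le hm hq1 x)
      have hy1 := abs_le.1 (abs_sq_mul_two_mul_add_sq_div_le hm hq1 y)
      have hw2 := abs_le.1 hw1
      rw [abs_le]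
      constructor <;> linarith [hx1.1, hx1.2, hy1.1, hy1.2, hw2.1, hw2.2]
    have hp' : |1 - p| ≤ 1 := by rw [abs_of_nonneg (by linarith)]; linarith
    have h9 : |(1 - p) * R| ≤ 1 * (5 + 4 * x ^ 2 + 4 * y ^ 2 + 2 * w ^ 2) := by
      rw [abs_mul]
      exact mul_le_mul hp' h1 (abs_nonneg _) zero_le_one
    refine (abs_add_le _ _).trans ?_
    have hr : 0 ≤ β ^ 2 / 4 * (1 / (p * q)) := by positivity
    rw [abs_mul, abs_of_nonneg hr, meanError, ← hq]
    have h10 := mul_le_mul_of_nonneg_left h9 hr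
    have hr2 : 0 ≤ 16 * β ^ 3 * (1 / (p * q)) ^ 2 := by positivity
    have hT : 1 * (5 + 4 * x ^ 2 + 4 * y ^ 2 + 2 * w ^ 2) ≤ 5 * (1 + x ^ 2 + y ^ 2 + w ^ 2) := by
      linarith [sq_nonneg x, sq_nonneg y, sq_nonneg w]
    have hT1 : 1 ≤ 1 + x ^ 2 + y ^ 2 + w ^ 2 := by
      linarith [sq_nonneg x, sq_nonneg y, sq_nonneg w]
    refine (add_le_add (h10.trans (mul_le_mul_of_nonneg_left hT hr))
      (he.trans (le_mul_of_one_le_right hr2 hT1))).trans (le_of_eq ?_)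
    ring
  · rw [hint, ← Real.exp_nat_mul, ← Real.exp_add, sum_edgeCoeff_add_sq, sum_spin_eq (m := m) hN σ,
      sum_spin_eq (m := m) hN τ, sum_spin_eq (m := m ^ 2) hN (σ * τ), hlm]
    congr 1
    rw [← hx, ← hy, ← hw, ← hq, hq2, hR]
    have : q ≠ 0 := by positivity
    push_cast
    field_simp
    ring

end Moments

/-! ### Gibbs weights relative to independent spins -/

/-- The Gibbs weight, up to a factor that does not depend on the configuration, relative to
independent spins of mean `tanh a`. -/
noncomputable def relWeight (β p a : ℝ) {N : ℕ} (b : Fin N → Fin N → ℝ) (σ : Config N) : ℝ :=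
  Real.exp (β * fluct (Real.tanh a) σ ^ 2 / 2) *
    Real.exp (∑ i, ∑ j, edgeCoeff (β / (2 * N * p)) (Real.tanh a) σ i j * (b i j - p))

/-- The unnormalized Gibbs expectation of `g` of the rescaled magnetization. -/
noncomputable def gibbsSum (β p a : ℝ) {N : ℕ} (b : Fin N → Fin N → ℝ) (g : ℝ → ℝ) : ℝ :=
  ∑ σ : Config N, prodWeight a σ * (g (fluct (Real.tanh a) σ) * relWeight β p a b σ)

theorem exp_neg_hamiltonian {β p h a : ℝ} {N : ℕ} (hN : 1 ≤ N) (hp : 0 < p)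
    (ha : a = β * (Real.tanh a + h)) (b : Fin N → Fin N → ℝ) :
    ∃ D > 0, ∀ σ : Config N, Real.exp (-β * hamiltonian N p h b σ) =
      D * (prodWeight a σ * relWeight β p a b σ) := by
  have hN' : (0 : ℝ) < N := by exact_mod_cast hN
  have hc := Real.cosh_pos a
  set m := Real.tanh a with hm
  set γ := β / (2 * N * p) with hγ
  -- `D` collects the product normalization, the m² part of the edge sum, random but independent of
  -- σ, and the constant from completing the square. The linear terms match by the fixed-point
  -- equation `ha`.
  refine ⟨(2 * Real.cosh a) ^ N * Real.exp (γ * m ^ 2 * (∑ i, ∑ j, (b i j - p)) - β * N * m ^ 2 / 2),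
    by positivity, fun σ => ?_⟩
  have hw : (2 * Real.cosh a) ^ N * prodWeight a σ = Real.exp (a * ∑ i, spin σ i) := by
    rw [prodWeight, Finset.prod_div_distrib, ← Real.exp_sum, ← Finset.mul_sum, Finset.prod_const,
      Finset.card_univ, Fintype.card_fin]
    field_simp
  have hx : fluct m σ ^ 2 = (∑ i, spin σ i) ^ 2 / N - 2 * m * (∑ i, spin σ i) + N * m ^ 2 := by
    rw [fluct, mul_pow, div_pow, Real.sq_sqrt hN'.le]
    field_simp
    ring
  have hX : ∑ i, ∑ j, edgeCoeff γ m σ i j * (b i j - p) =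
      γ * (∑ i, ∑ j, b i j * spin σ i * spin σ j) - γ * p * (∑ i, spin σ i) ^ 2 -
        γ * m ^ 2 * ∑ i, ∑ j, (b i j - p) := by
    rw [← sum_sum_spin_mul]
    simp only [Finset.mul_sum, ← Finset.sum_sub_distrib]
    refine Finset.sum_congr rfl fun i _ => Finset.sum_congr rfl fun j _ => ?_
    rw [edgeCoeff]
    ring
  have hγp : γ * p = β / 2 / N := by rw [hγ]; field_simp
  have hγβ : β * (1 / (2 * N * p)) = γ := by rw [hγ]; ring
  rw [relWeight, mul_assoc, mul_left_comm (Real.exp _) (prodWeight a σ), ← mul_assoc, hw,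
    ← Real.exp_add, ← Real.exp_add, ← Real.exp_add, hX, hx, hamiltonian]
  congr 1
  linear_combination (∑ i, ∑ j, b i j * spin σ i * spin σ j) * hγβ - (∑ i, spin σ i) * ha +
    (∑ i, spin σ i) ^ 2 * hγp

theorem integral_magnetizationLaw {β p h a : ℝ} {N : ℕ} (hN : 1 ≤ N) (hp : 0 < p)
    (ha : a = β * (Real.tanh a + h)) (hm : mPlus β h = Real.tanh a) (b : Fin N → Fin N → ℝ)
    (g : ℝ → ℝ) :
    ∫ x, g x ∂(magnetizationLaw N p β h b : Measure ℝ) =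
      gibbsSum β p a b g / gibbsSum β p a b 1 := by
  obtain ⟨D, hD, hσ⟩ := exp_neg_hamiltonian hN hp ha b
  have hg0 : ∀ σ, 0 ≤ gibbs N p β h b σ := fun σ =>
    div_nonneg (Real.exp_pos _).le (Finset.sum_nonneg fun _ _ => (Real.exp_pos _).le)
  have h1 : ∫ x, g x ∂(magnetizationLaw N p β h b : Measure ℝ) =
      ∑ σ : Config N, gibbs N p β h b σ * g (fluct (Real.tanh a) σ) := by
    rw [magnetizationLaw, FiniteMeasure.toMeasure_sum, integral_finsetSum_measure]
    · refine Finset.sum_congr rfl fun σ _ => ?_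
      rw [FiniteMeasure.toMeasure_smul, integral_smul_nnreal_measure, NNReal.smul_def,
        Real.coe_toNNReal _ (hg0 σ), smul_eq_mul, hm]
      congr 1
      exact integral_dirac _ _
    · intro σ _
      rw [FiniteMeasure.toMeasure_smul]
      exact Integrable.smul_measure_nnreal (integrable_dirac (by simp))
  have h2 : partitionFunction N p β h b = D * gibbsSum β p a b 1 := by
    rw [partitionFunction, gibbsSum, Finset.mul_sum]
    simp_rw [hσ]
    simp
  rw [h1, gibbsSum, Finset.sum_div]
  refine Finset.sum_congr rfl fun σ _ => ?_
  rw [gibbs, hσ, h2, mul_div_mul_left _ _ hD.ne']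
  ring

/-! ### Second moment of the normalized Gibbs sums -/

section SecondMoment

variable {Ω : Type*} [MeasurableSpace Ω] {P : Measure Ω} [IsProbabilityMeasure P] {N : ℕ}
  {β p a : ℝ} {ε : Fin N → Fin N → Ω → ℝ}

/-- Expanding the square gives a sum over two replicas and a sum over one. After normalization by
e^{-V} the expected edge factors become exp Ψ and exp Φ; replacing them by 1 costs O(`meanError`)
and leaves the exact square (T1 - I)², which involves no disorder. -/
theorem IsErdosRenyi.integral_sq_sub_le (hε : IsErdosRenyi P N p ε) (hN : 1 ≤ N) (hp0 : 0 < p)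
    (hp1 : p ≤ 1) (hβ : 0 < β) (hγ : 4 * (β / (2 * N * p)) ≤ 1 / 2) {δ C B : ℝ} (hδ : 0 < δ)
    (hη : meanError β p N ≤ δ)
    (hC1 : ∑ σ : Config N, prodWeight a σ * (Real.exp (β * fluct (Real.tanh a) σ ^ 2 / 2) *
        Real.exp (δ * (1 + fluct (Real.tanh a) σ ^ 2))) ≤ C)
    (hC2 : ∑ q : Config N × Config N, prodWeight a q.1 * prodWeight a q.2 *
        (Real.exp (β * fluct (Real.tanh a) q.1 ^ 2 / 2) *
          Real.exp (β * fluct (Real.tanh a) q.2 ^ 2 / 2) *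
        Real.exp (δ * (1 + fluct (Real.tanh a) q.1 ^ 2 + fluct (Real.tanh a) q.2 ^ 2 +
          fluct (Real.tanh a ^ 2) (q.1 * q.2) ^ 2))) ≤ C)
    {g : ℝ → ℝ} (hg : ∀ u, |g u| ≤ B) (I : ℝ) :
    Integrable (fun ω => (Real.exp (-logMean β p (Real.tanh a) N) *
      gibbsSum β p a (fun i j => ε i j ω) g - I) ^ 2) P ∧
    ∫ ω, (Real.exp (-logMean β p (Real.tanh a) N) *
        gibbsSum β p a (fun i j => ε i j ω) g - I) ^ 2 ∂P ≤
      (∑ σ : Config N, prodWeight a σ * (g (fluct (Real.tanh a) σ) *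
          Real.exp (β * fluct (Real.tanh a) σ ^ 2 / 2)) - I) ^ 2 +
        (B ^ 2 / δ * C + 2 * |I| * (B / δ * C)) * meanError β p N := by
  have hB : 0 ≤ B := (abs_nonneg _).trans (hg 0)
  have hm : |Real.tanh a| ≤ 1 :=
    abs_le.2 ⟨(Real.neg_one_lt_tanh a).le, (Real.tanh_lt_one a).le⟩
  have hη0 := meanError_nonneg (N := N) hβ hp0
  set m := Real.tanh a
  set V := logMean β p m N
  set γ := β / (2 * N * p)
  choose Φ hΦ hΦi using hε.expect_weight hN hp0 hp1 hβ hm hγ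
  choose Ψ hΨ hΨi using hε.expect_weight_pair hN hp0 hp1 hβ hm hγ
  set F : Config N → ℝ := fun σ => g (fluct m σ) * Real.exp (β * fluct m σ ^ 2 / 2) with hF
  set G : Config N → Ω → ℝ := fun σ ω =>
    Real.exp (∑ i, ∑ j, edgeCoeff γ m σ i j * (ε i j ω - p)) with hG
  have hFb : ∀ σ, |F σ| ≤ B * Real.exp (β * fluct m σ ^ 2 / 2) := fun σ => by
    rw [hF]
    simp only [abs_mul, Real.abs_exp]
    exact mul_le_mul_of_nonneg_right (hg _) (Real.exp_pos _).le
  have hGi : ∀ σ, Integrable (G σ) P := fun σ => hε.integrable_exp_sum hp0.le hp1 _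
  have hGG : ∀ σ τ, (fun ω => G σ ω * G τ ω) = fun ω =>
      Real.exp (∑ i, ∑ j, (edgeCoeff γ m σ i j + edgeCoeff γ m τ i j) * (ε i j ω - p)) := by
    intro σ τ
    ext ω
    rw [hG, ← Real.exp_add]
    simp only [← Finset.sum_add_distrib, add_mul]
  have hGGi : ∀ σ τ, Integrable (fun ω => G σ ω * G τ ω) P := fun σ τ => by
    rw [hGG]
    exact hε.integrable_exp_sum hp0.le hp1 _
  have hE : Real.exp (-V) * Real.exp V = 1 := by rw [← Real.exp_add]; simp
  have hsum : ∀ ω, gibbsSum β p a (fun i j => ε i j ω) g =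
      ∑ σ, prodWeight a σ * F σ * G σ ω := fun ω =>
    Finset.sum_congr rfl fun σ _ => by rw [relWeight, hF, hG]; ring
  have hexpand : ∀ ω, (Real.exp (-V) * gibbsSum β p a (fun i j => ε i j ω) g - I) ^ 2 =
      ∑ q : Config N × Config N, (Real.exp (-V) ^ 2 * (prodWeight a q.1 * F q.1 *
        (prodWeight a q.2 * F q.2))) * (G q.1 ω * G q.2 ω) -
      ∑ σ, (2 * I * Real.exp (-V) * (prodWeight a σ * F σ)) * G σ ω + I ^ 2 := by
    intro ω
    rw [hsum, sub_sq, mul_pow, sq (∑ σ, _), Fintype.sum_mul_sum, Fintype.sum_prod_type]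
    simp only [Finset.mul_sum, Finset.sum_mul]
    congr 2
    · exact Finset.sum_congr rfl fun σ _ => Finset.sum_congr rfl fun τ _ => by ring
    · exact Finset.sum_congr rfl fun σ _ => by ring
  have hi1 : Integrable (fun ω => ∑ q : Config N × Config N, (Real.exp (-V) ^ 2 *
      (prodWeight a q.1 * F q.1 * (prodWeight a q.2 * F q.2))) * (G q.1 ω * G q.2 ω)) P :=
    integrable_finsetSum _ fun q _ => (hGGi q.1 q.2).const_mul _
  have hi2 : Integrable (fun ω => ∑ σ,
      (2 * I * Real.exp (-V) * (prodWeight a σ * F σ)) * G σ ω) P :=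
    integrable_finsetSum _ fun σ _ => (hGi σ).const_mul _
  simp_rw [hexpand]
  refine ⟨(hi1.sub hi2).add (integrable_const _), ?_⟩
  have hint : ∫ ω, (∑ q : Config N × Config N, (Real.exp (-V) ^ 2 * (prodWeight a q.1 * F q.1 *
        (prodWeight a q.2 * F q.2))) * (G q.1 ω * G q.2 ω) -
      ∑ σ, (2 * I * Real.exp (-V) * (prodWeight a σ * F σ)) * G σ ω + I ^ 2) ∂P =
      ∑ q : Config N × Config N, prodWeight a q.1 * prodWeight a q.2 *
        (F q.1 * F q.2 * Real.exp (Ψ q.1 q.2)) -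
      2 * I * ∑ σ, prodWeight a σ * (F σ * Real.exp (Φ σ)) + I ^ 2 := by
    rw [integral_add (f := fun ω => _ - _) (hi1.sub hi2) (integrable_const _), integral_sub hi1 hi2,
      integral_finsetSum _ fun q _ => (hGGi q.1 q.2).const_mul _,
      integral_finsetSum _ fun σ _ => (hGi σ).const_mul _, integral_const, probReal_univ,
      one_smul, Finset.mul_sum]
    congr 2
    · refine Finset.sum_congr rfl fun q _ => ?_
      rw [integral_const_mul, hGG, hΨi]
      linear_combination (prodWeight a q.1 * F q.1 * (prodWeight a q.2 * F q.2) *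
        Real.exp (Ψ q.1 q.2)) * (Real.exp (-V) * Real.exp V + 1) * hE
    · refine Finset.sum_congr rfl fun σ _ => ?_
      rw [integral_const_mul, hΦi]
      linear_combination (2 * I * (prodWeight a σ * F σ) * Real.exp (Φ σ)) * hE
  have hb1 := abs_sum_mul_exp_sub_sum_le (w := fun σ : Config N => prodWeight a σ) (F := F)
    (fun σ => (prodWeight_pos a σ).le) hB hFb hδ hη0 hη hΦ hC1
  have hb2 := abs_sum_mul_exp_sub_sum_le
    (w := fun q : Config N × Config N => prodWeight a q.1 * prodWeight a q.2)
    (F := fun q => F q.1 * F q.2) (Φ := fun q => Ψ q.1 q.2) (B := B ^ 2)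
    (V := fun q => Real.exp (β * fluct m q.1 ^ 2 / 2) * Real.exp (β * fluct m q.2 ^ 2 / 2))
    (fun q => (mul_pos (prodWeight_pos a q.1) (prodWeight_pos a q.2)).le) (sq_nonneg B)
    (fun q => by
      rw [abs_mul]
      refine (mul_le_mul (hFb q.1) (hFb q.2) (abs_nonneg _) (by positivity)).trans (le_of_eq ?_)
      ring)
    hδ hη0 hη (fun q => hΨ q.1 q.2) hC2
  have hprod : ∑ q : Config N × Config N, prodWeight a q.1 * prodWeight a q.2 * (F q.1 * F q.2) =
      (∑ σ, prodWeight a σ * F σ) ^ 2 := by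
    rw [sq, Fintype.sum_mul_sum, Fintype.sum_prod_type]
    exact Finset.sum_congr rfl fun σ _ => Finset.sum_congr rfl fun τ _ => by ring
  rw [hint]
  rw [hprod] at hb2
  set S1 := ∑ σ, prodWeight a σ * (F σ * Real.exp (Φ σ))
  set T1 := ∑ σ, prodWeight a σ * F σ
  have h3 : -(2 * I * (S1 - T1)) ≤ 2 * |I| * (B / δ * C * meanError β p N) := by
    refine (neg_le_abs _).trans ?_
    rw [abs_mul, abs_mul, abs_two]
    exact mul_le_mul_of_nonneg_left hb1 (by positivity)
  have h4 := (abs_le.1 hb2).2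
  have h5 : (T1 - I) ^ 2 = T1 ^ 2 - 2 * I * T1 + I ^ 2 := by ring
  rw [h5]
  linarith

end SecondMoment

/-! ### Convergence in probability as convergence along a filter -/

section Limit

variable {Ω : ℕ → Type*} [∀ N, MeasurableSpace (Ω N)]

/-- The filter of events whose complements have probability tending to zero. -/
def probFilter (P : ∀ N, Measure (Ω N)) : Filter (Σ N, Ω N) where
  sets := {S | Tendsto (fun N => P N {ω | (⟨N, ω⟩ : Σ N, Ω N) ∉ S}) atTop (𝓝 0)}
  univ_sets := by simp
  sets_of_superset {S T} hS hST :=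
    tendsto_of_tendsto_of_tendsto_of_le_of_le tendsto_const_nhds hS (fun _ => zero_le)
      fun N => measure_mono fun ω hω h => hω (hST h)
  inter_sets {S T} hS hT := by
    have h := Tendsto.add hS hT
    rw [add_zero] at h
    refine tendsto_of_tendsto_of_tendsto_of_le_of_le tendsto_const_nhds h (fun _ => zero_le)
      fun N => (measure_mono fun ω hω => ?_).trans (measure_union_le _ _)
    by_contra hn
    exact hω ⟨by_contra fun h1 => hn (Or.inl h1), by_contra fun h1 => hn (Or.inr h1)⟩

theorem mem_probFilter {P : ∀ N, Measure (Ω N)} {S : Set (Σ N, Ω N)} :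
    S ∈ probFilter P ↔ Tendsto (fun N => P N {ω | (⟨N, ω⟩ : Σ N, Ω N) ∉ S}) atTop (𝓝 0) :=
  Iff.rfl

theorem tendsto_probFilter_of_integral_sq {P : ∀ N, Measure (Ω N)} [∀ N, IsProbabilityMeasure (P N)]
    {f : ∀ N, Ω N → ℝ} {I : ℝ} (hf : ∀ᶠ N in atTop, Integrable (fun ω => (f N ω - I) ^ 2) (P N))
    (h : Tendsto (fun N => ∫ ω, (f N ω - I) ^ 2 ∂(P N)) atTop (𝓝 0)) :
    Tendsto (fun q : Σ N, Ω N => f q.1 q.2) (probFilter P) (𝓝 I) := by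
  rw [Metric.tendsto_nhds]
  intro δ hδ
  refine mem_probFilter.2 ?_
  have h1 : Tendsto (fun N => ENNReal.ofReal ((∫ ω, (f N ω - I) ^ 2 ∂(P N)) / δ ^ 2)) atTop
      (𝓝 0) := by
    have := (ENNReal.continuous_ofReal.tendsto _).comp (h.div_const (δ ^ 2))
    rwa [zero_div, ENNReal.ofReal_zero] at this
  refine tendsto_of_tendsto_of_tendsto_of_le_of_le' tendsto_const_nhds h1
    (Eventually.of_forall fun _ => zero_le) ?_
  filter_upwards [hf] with N hN
  have h2 := mul_meas_ge_le_integral_of_nonneg (ae_of_all (P N) fun ω => sq_nonneg (f N ω - I)) hN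
    (δ ^ 2)
  refine (measure_mono (t := {ω | δ ^ 2 ≤ (f N ω - I) ^ 2}) fun ω hω => ?_).trans ?_
  · have h3 : δ ≤ |f N ω - I| := by
      have : ¬ dist (f N ω) I < δ := hω
      rwa [not_lt, Real.dist_eq] at this
    show δ ^ 2 ≤ (f N ω - I) ^ 2
    rw [← sq_abs (f N ω - I)]
    gcongr
  · rw [← ENNReal.ofReal_toReal (measure_ne_top (P N) _)]
    refine ENNReal.ofReal_le_ofReal ?_
    rw [le_div_iff₀ (by positivity), mul_comm]
    exact h2

variable {P : ∀ N, Measure (Ω N)} [∀ N, IsProbabilityMeasure (P N)] {p : ℕ → ℝ}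
  {ε : ∀ N, Fin N → Fin N → Ω N → ℝ} {β a : ℝ}

theorem tendsto_gibbsSum (ha : 0 < a) (hβ : 0 < β) (hβa : β * (Real.tanh a / a) < 1)
    (hp : ∀ N, 1 ≤ N → 0 < p N ∧ p N ≤ 1)
    (hpN : Tendsto (fun N : ℕ => 1 / (p N * Real.sqrt N)) atTop (𝓝 0))
    (hε : ∀ N, IsErdosRenyi (P N) N (p N) (ε N)) (g : BoundedContinuousFunction ℝ ℝ) :
    Tendsto (fun q : Σ N, Ω N => Real.exp (-logMean β (p q.1) (Real.tanh a) q.1) *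
        gibbsSum β (p q.1) a (fun i j => ε q.1 i j q.2) g) (probFilter P)
      (𝓝 (∫ u, g u * Real.exp (β * u ^ 2 / 2)
        ∂(gaussianReal 0 (1 - Real.tanh a ^ 2).toNNReal))) := by
  obtain ⟨δ, hδ, C, hC⟩ := exists_exp_moment_bound ha hβ hβa
  set I := ∫ u, g u * Real.exp (β * u ^ 2 / 2) ∂(gaussianReal 0 (1 - Real.tanh a ^ 2).toNNReal)
  have hη : Tendsto (fun N => meanError β (p N) N) atTop (𝓝 0) := by
    have := (hpN.const_mul (5 / 4 * β ^ 2)).add ((hpN.pow 2).const_mul (16 * β ^ 3))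
    simpa [meanError] using this
  -- The Laplace expansion needs small coefficients: 4γ = 2β/(pN) ≤ 2β/(p²N), using p ≤ 1.
  have hγ : ∀ᶠ N : ℕ in atTop, 4 * (β / (2 * N * p N)) ≤ 1 / 2 := by
    have h1 : Tendsto (fun N : ℕ => 2 * β * (1 / (p N * Real.sqrt N)) ^ 2) atTop (𝓝 0) := by
      simpa using (hpN.pow 2).const_mul (2 * β)
    filter_upwards [h1.eventually_lt_const (by norm_num : (0 : ℝ) < 1 / 2),
      eventually_ge_atTop 1] with N hN hN1
    obtain ⟨hp0, hp1⟩ := hp N hN1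
    have hN' : (0 : ℝ) < N := by exact_mod_cast hN1
    refine le_trans ?_ hN.le
    rw [div_pow, mul_pow, Real.sq_sqrt hN'.le]
    have : 4 * (β / (2 * N * p N)) = 2 * β * (1 / (p N * N)) := by field_simp; norm_num
    rw [this, one_pow]
    gcongr
    nlinarith
  have hlim := tendsto_sum_prodWeight_mul_exp_sq ha hβ.le hβa g
  have hall := fun N h1 h2 (h3 : 1 ≤ N) =>
    (hε N).integral_sq_sub_le (a := a) h3 (hp N h3).1 (hp N h3).2 hβ h1 hδ h2 (hC N h3).1
      (hC N h3).2 (B := ‖g‖) (fun u => g.norm_coe_le_norm u) I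
  have hev : ∀ᶠ N : ℕ in atTop, 4 * (β / (2 * N * p N)) ≤ 1 / 2 ∧ meanError β (p N) N ≤ δ ∧ 1 ≤ N :=
    hγ.and ((hη.eventually_le_const hδ).and (eventually_ge_atTop 1))
  refine tendsto_probFilter_of_integral_sq
    (f := fun N ω => Real.exp (-logMean β (p N) (Real.tanh a) N) *
        gibbsSum β (p N) a (fun i j => ε N i j ω) g) (hev.mono fun N h => (hall N h.1 h.2.1 h.2.2).1) ?_
  have hup := ((hlim.sub_const I).pow 2).add
    (hη.const_mul (‖g‖ ^ 2 / δ * C + 2 * |I| * (‖g‖ / δ * C)))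
  rw [sub_self, mul_zero, add_zero, zero_pow two_ne_zero] at hup
  exact tendsto_of_tendsto_of_tendsto_of_le_of_le' tendsto_const_nhds hup
    (Eventually.of_forall fun N => integral_nonneg fun ω => sq_nonneg _)
    (hev.mono fun N h => (hall N h.1 h.2.1 h.2.2).2)

end Limit

/-! ### The fixed point and the conclusion -/

theorem mPlus_pos {β h : ℝ} (hβ : 0 < β) (hh : 0 < h) : 0 < mPlus β h := by
  have hc : Continuous Real.tanh :=
    continuous_iff_continuousAt.2 fun x => (hasDerivAt_tanh x).continuousAt
  obtain ⟨z, hz, hz0⟩ := intermediate_value_Icc (zero_le_one' ℝ)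
    (f := fun z => z - Real.tanh (β * (z + h))) (by fun_prop)
    (show (0 : ℝ) ∈ Set.Icc _ _ from
      ⟨by have := tanh_pos (mul_pos hβ hh); simp; linarith,
        by have := Real.tanh_lt_one (β * (1 + h)); linarith⟩)
  have hz' : z = Real.tanh (β * (z + h)) := sub_eq_zero.1 hz0
  have hzpos : 0 < z := by
    rw [hz']
    exact tanh_pos (mul_pos hβ (by linarith [hz.1]))
  exact hzpos.trans_le ((isGreatest_mPlus β h).2 hz')

/-- Along `probFilter` ordinary limit rules apply: weak convergence is tested on one bounded
continuous g at a time, and limits of numerator and denominator may be divided. -/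
theorem tendsto_magnetizationLaw {Ω : ℕ → Type*} [∀ N, MeasurableSpace (Ω N)]
    {P : ∀ N, Measure (Ω N)} [∀ N, IsProbabilityMeasure (P N)] {p : ℕ → ℝ}
    {ε : ∀ N, Fin N → Fin N → Ω N → ℝ} {β h : ℝ} (hβ : 0 < β) (hh : 0 < h)
    (hp : ∀ N, 1 ≤ N → 0 < p N ∧ p N ≤ 1)
    (hpN : Tendsto (fun N : ℕ => 1 / (p N * Real.sqrt N)) atTop (𝓝 0))
    (hε : ∀ N, IsErdosRenyi (P N) N (p N) (ε N)) :
    0 < sigmaSq β h ∧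
    Tendsto (fun q : Σ N, Ω N => magnetizationLaw q.1 (p q.1) β h (fun i j => ε q.1 i j q.2))
      (probFilter P) (𝓝 (normalFM (sigmaSq β h))) := by
  have hm0 := mPlus_pos hβ hh
  set a := β * (mPlus β h + h) with ha
  have hma : mPlus β h = Real.tanh a := (isGreatest_mPlus β h).1
  have ha0 : 0 < a := mul_pos hβ (by linarith)
  -- The left side equals m/(m + h), so the bound comes from h > 0.
  have hβa : β * (Real.tanh a / a) < 1 := by
    rw [← hma, ha, ← mul_div_assoc, mul_div_mul_left _ _ hβ.ne', div_lt_one (by linarith)]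
    linarith
  set s := 1 - Real.tanh a ^ 2 with hs
  have hs0 : 0 < s := by
    have := tanh_pos ha0
    have := Real.tanh_lt_one a
    rw [hs]; nlinarith
  have hβs : 0 < 1 - β * s := by
    have := mul_le_mul_of_nonneg_left (one_sub_tanh_sq_le ha0) hβ.le
    rw [← hs] at this
    linarith
  have hsig : sigmaSq β h = s / (1 - β * s) := by rw [sigmaSq, hma]
  have hsig0 : 0 < sigmaSq β h := by rw [hsig]; positivity
  refine ⟨hsig0, FiniteMeasure.tendsto_iff_forall_integral_tendsto.2 fun g => ?_⟩
  -- Precisions subtract: 1/s - β = 1/σ². The prefactor √(σ²/s) is common to numerator and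
  -- denominator.
  have hint := fun g : ℝ → ℝ => integral_mul_exp_gaussianReal (b := β) (v := s.toNNReal)
    (w := (sigmaSq β h).toNNReal) (by simpa using hs0) (by simpa using hsig0)
    (by
      rw [Real.coe_toNNReal _ hs0.le, Real.coe_toNNReal _ hsig0.le, hsig, inv_div]
      field_simp) g
  have hg := tendsto_gibbsSum ha0 hβ hβa hp hpN hε g
  have h1 := tendsto_gibbsSum ha0 hβ hβa hp hpN hε (1 : BoundedContinuousFunction ℝ ℝ)
  rw [hint] at hg h1
  set c := Real.sqrt ((sigmaSq β h).toNNReal / s.toNNReal) with hc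
  have hc0 : 0 < c := by
    rw [hc, Real.coe_toNNReal _ hs0.le, Real.coe_toNNReal _ hsig0.le]
    exact Real.sqrt_pos.2 (div_pos hsig0 hs0)
  have hI1 : ∫ u, (1 : BoundedContinuousFunction ℝ ℝ) u
      ∂(gaussianReal 0 (sigmaSq β h).toNNReal) = 1 := by simp
  rw [hI1, mul_one] at h1
  have hdiv := hg.div h1 hc0.ne'
  rw [mul_div_cancel_left₀ _ hc0.ne'] at hdiv
  refine hdiv.congr' ?_
  -- N = 0 has to be excluded, since the bounds on p and the rewriting of the Gibbs weights require
  -- N ≥ 1.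
  have hev : ∀ᶠ q : Σ N, Ω N in probFilter P, 1 ≤ q.1 := by
    refine mem_probFilter.2 (tendsto_const_nhds.congr' ?_)
    filter_upwards [eventually_ge_atTop 1] with N hN
    refine (measure_mono_null (t := ∅) (fun ω hω => ?_) measure_empty).symm
    exact (hω hN).elim
  filter_upwards [hev] with q hq
  rw [integral_magnetizationLaw hq (hp q.1 hq).1 (by rw [← hma]) hma]
  exact mul_div_mul_left _ _ (Real.exp_pos _).ne'

theorem tendsto_one_div_mul_sqrt {p : ℕ → ℝ} (hp : ∀ N, 1 ≤ N → 0 < p N ∧ p N ≤ 1)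
    (hpN : Tendsto (fun N : ℕ => p N ^ 3 * (N : ℝ)) atTop atTop) :
    Tendsto (fun N : ℕ => 1 / (p N * Real.sqrt N)) atTop (𝓝 0) := by
  simp only [one_div]
  refine tendsto_inv_atTop_zero.comp
    -- Since p ≤ 1, p³N ≤ p²N, so p√N is at least √(p³N).
    (tendsto_atTop_mono' _ ?_ (Real.tendsto_sqrt_atTop.comp hpN))
  filter_upwards [eventually_ge_atTop 1] with N hN
  obtain ⟨h0, h1⟩ := hp N hN
  have hN' : (0 : ℝ) ≤ N := Nat.cast_nonneg N
  refine Real.sqrt_le_iff.2 ⟨by positivity, ?_⟩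
  rw [mul_pow, Real.sq_sqrt hN']
  refine mul_le_mul_of_nonneg_right ?_ hN'
  exact pow_le_pow_of_le_one h0.le h1 (by norm_num)

end DiluteCurieWeiss

theorem theorem1p2 (β h : ℝ) (hβ : 0 < β) (hh : 0 < h)
    (p : ℕ → ℝ) (hp : ∀ N, 1 ≤ N → 0 < p N ∧ p N ≤ 1)
    (hpN : Tendsto (fun N : ℕ => p N ^ 3 * (N : ℝ)) atTop atTop)
    (Ω : ℕ → Type*) [∀ N, MeasurableSpace (Ω N)]
    (P : ∀ N, Measure (Ω N)) [∀ N, IsProbabilityMeasure (P N)]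
    (ε : ∀ N, Fin N → Fin N → Ω N → ℝ)
    (hε : ∀ N, DiluteCurieWeiss.IsErdosRenyi (P N) N (p N) (ε N)) :
    -- the limiting variance is a genuine (positive) variance
    0 < DiluteCurieWeiss.sigmaSq β h ∧
    -- convergence in probability, in terms of neighbourhoods for the weak topology
    (∀ U ∈ 𝓝 (DiluteCurieWeiss.normalFM (DiluteCurieWeiss.sigmaSq β h)),
      Tendsto (fun N => P N {ω | DiluteCurieWeiss.magnetizationLaw N (p N) β h
        (fun i j => ε N i j ω) ∉ U}) atTop (𝓝 0)) ∧
    -- convergence in probability, for any metric that generates the weak topology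
    (∀ ρ : MetricSpace (FiniteMeasure ℝ),
      ρ.toUniformSpace.toTopologicalSpace =
        (inferInstance : TopologicalSpace (FiniteMeasure ℝ)) →
      ∀ δ : ℝ, 0 < δ →
        Tendsto (fun N => P N {ω | δ < ρ.dist
          (DiluteCurieWeiss.magnetizationLaw N (p N) β h (fun i j => ε N i j ω))
          (DiluteCurieWeiss.normalFM (DiluteCurieWeiss.sigmaSq β h))}) atTop (𝓝 0)) := by
  obtain ⟨hσ, hlim⟩ := DiluteCurieWeiss.tendsto_magnetizationLaw hβ hh hp
    (DiluteCurieWeiss.tendsto_one_div_mul_sqrt hp hpN) hε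
  have hU : ∀ U ∈ 𝓝 (DiluteCurieWeiss.normalFM (DiluteCurieWeiss.sigmaSq β h)),
      Tendsto (fun N => P N {ω | DiluteCurieWeiss.magnetizationLaw N (p N) β h
        (fun i j => ε N i j ω) ∉ U}) atTop (𝓝 0) := fun U hU => hlim hU
  refine ⟨hσ, hU, fun ρ hρ δ hδ => ?_⟩
  refine tendsto_of_tendsto_of_tendsto_of_le_of_le tendsto_const_nhds (hU
    {L | ρ.dist L (DiluteCurieWeiss.normalFM (DiluteCurieWeiss.sigmaSq β h)) < δ} ?_)
    (fun _ => zero_le) fun N => measure_mono fun ω hω hω' => ?_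
  · have hb := @Metric.ball_mem_nhds _ ρ.toPseudoMetricSpace
      (DiluteCurieWeiss.normalFM (DiluteCurieWeiss.sigmaSq β h)) δ hδ
    rw [hρ] at hb
    exact hb
  · exact lt_asymm (a := δ) hω hω'
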